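/- Let $\mathcal D$ be a pointed proper simplicial model category. For $X\in\mathcal D$ let $CX$ be the strict cofiber of the end inclusion $i_1:X\to X\otimes I$ of the cylinder, let $i^X:X\to CX$ be induced by $i_0$, and let $C^0X=X$, $C^{k}X=C(C^{k-1}X)$. Let $n\ge 0$ and let $X_\ast=(X_1\xrightarrow{f_1}X_2\to\cdots\xrightarrow{f_{n+2}}X_{n+3})$ be a linear diagram in $\mathcal D$. An *$n$-th order cubical Toda system* $\mathcal X$ of length $n+2$ over $X_\ast$ consists of maps $F^{(k)}_j:C^kX_j\to X_{j+k+1}$ for $0\le k\le n$ and $1\le j\le n+2-k$, with $F^{(0)}_j=f_j$, such that for all $1\le r\le k$ $$F^{(k)}_j\circ C^{k-r}(i^{C^{r-1}X_j})=F^{(k-r)}_{j+r}\circ C^{k-r}(F^{(r-1)}_j).$$ For $a\in\{0,1\}^m$ (ordered coordinatewise) let $\deg a$ be the number of $1$'s in $a$ and $\operatorname{init}a$ the length of its initial segment of $1$'s, and let $r_k$ be the sequence with a single $0$, in place $k$. Consider the following diagrams indexed by $\{0,1\}^m$. * $\mathbb C^{(m)}X(a)=C^{\deg a}X$; the edge replacing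 a $0$ in place $s$ of $a$ by $1$ is $C^{\deg a-k}(i^{C^kX})$, where $k=a_1+\dots+a_{s-1}$. * $M(a)=C^{\deg a-\operatorname{init}a}X_{2+\operatorname{init}a}$ ($m=n$); the edge replacing a $0$ in place $s$ of $a$ by $1$ is $C^{\deg a-\operatorname{init}a-\ell}(F^{(\ell)}_{2+\operatorname{init}a})$ if $s=\operatorname{init}a+1$, where $\ell$ is the number of consecutive $1$'s starting at place $s+1$, and $C^{\deg a-r}(i^{C^{r-\operatorname{init}a}X_{2+\operatorname{init}a}})$ with $r=a_1+\dots+a_{s-1}$ otherwise. * $x(1,\dots,1)=X_{n+3}$ and $x(a)=CM(a)$ for $a\ne(1,\dots,1)$ ($m=n$); the edge $r_k\to(1,\dots,1)$ is $F^{(n-k+1)}_{k+1}$, and the other edges are the cones of those of $M$. Let $A:\mathbb C^{(n)}X_1\to M$ have components $C^{\deg a-\operatorname{init}a}F^{(\operatorname{init}a)}_1$, and let $B:M\to x$ have components $f_{n+2}$ at $(1,\dots,1)$ and $i^{M(a)}$ elsewhere. The system $\mathcal X$ is *strongly cofibrant* if the diagram $\mathbb C^{(n)}X_1\xrightarrow{A}M\xrightarrow{B}x$,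 indexed by the poset $P=\{0<1<2\}\times\{0,1\}^n$, is projectively cofibrant; that is, for each $p\in P$ the map to the value at $p$ from the colimit of the values at all $q<p$ is a cofibration. Let $L^nX_1$ be the colimit of the restriction of $\mathbb C^{(n+1)}X_1$ to $\{0,1\}^{n+1}\setminus\{(1,\dots,1)\}$. The *cubical Toda bracket* of $\mathcal X$ is the map $T^{(n)}_1\mathcal X:L^nX_1\to X_{n+3}$ induced by the maps $$F^{(n-k+1)}_{k+1}\circ C^{n-k+1}(F^{(k-1)}_1):\mathbb C^{(n+1)}X_1(r_k)=C^nX_1\to X_{n+3}\qquad(1\le k\le n+1).$$ Suppose that $\mathcal X$ is strongly cofibrant and that $T^{(n)}_1\mathcal X$ is nullhomotopic, i.e. represents the zero map in $\operatorname{Ho}\mathcal D$. Then $X_\ast$ is rectifiable: there is a linear diagram $X'_\ast=(X'_1\xrightarrow{f'_1}\cdots\xrightarrow{f'_{n+2}}X'_{n+3})$ in $\mathcal D$, connected to $X_\ast$ by a zigzag of objectwise weak equivalences of linear diagrams, with $f'_{j+1}\circ f'_j=0$ for every $1\le j\le n+1$. -/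

import Mathlib

open CategoryTheory CategoryTheory.Limits CategoryTheory.MonoidalCategory HomotopicalAlgebra
open CategoryTheory.SimplicialCategory

universe v u

-- Morphisms should be read off from the category structure alone.
attribute [-instance] catToReflQuiver

namespace Toda

/-! ### Simplicial model categories -/

section Simplicial

variable {D : Type u} [Category.{v} D] [SimplicialCategory D]

/-- The map `sHom T Y ⟶ (sHom X Y)^K` induced by `η : K ⟶ sHom X T`. The object `T` together with
`η` is a tensor `X ⊗ K` when it is an isomorphism for every `Y`. -/
noncomputable def tensorComparison {K : SSet.{v}} {X T : D} (η : K ⟶ sHom X T) (Y : D) :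
    sHom T Y ⟶ (ihom K).obj (sHom X Y) :=
  MonoidalClosed.curry (η ▷ sHom T Y ≫ sHomComp X T Y)

/-- The map `sHom X P ⟶ (sHom X Y)^K` induced by `ε : K ⟶ sHom P Y`. The object `P` together with
`ε` is a cotensor `Y ^ K` when it is an isomorphism for every `X`. -/
noncomputable def cotensorComparison {K : SSet.{v}} {P Y : D} (ε : K ⟶ sHom P Y) (X : D) :
    sHom X P ⟶ (ihom K).obj (sHom X Y) :=
  MonoidalClosed.curry ((β_ K (sHom X P)).hom ≫ sHom X P ◁ ε ≫ sHomComp X P Y)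

/-- The map `sHom B X ⟶ sHom A X ×_{sHom A Y} sHom B Y` induced by `i : A ⟶ B`, `p : X ⟶ Y`. -/
noncomputable def pullbackHom {A B X Y : D} (i : A ⟶ B) (p : X ⟶ Y) :
    sHom B X ⟶
      pullback (eHomWhiskerLeft SSet.{v} A p) (eHomWhiskerRight SSet.{v} i Y) :=
  pullback.lift (eHomWhiskerRight SSet.{v} i X) (eHomWhiskerLeft SSet.{v} B p)
    (eHom_whisker_exchange SSet.{v} i p).symm

/-- Postcomposing `η : K ⟶ sHom X T` with a morphism `T ⟶ Y`. -/
noncomputable def transpose {K : SSet.{v}} {X T : D} (η : K ⟶ sHom X T) {Y : D} (g : T ⟶ Y) :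
    K ⟶ sHom X Y :=
  η ≫ eHomWhiskerLeft SSet.{v} X g

lemma transpose_bijective {K : SSet.{v}} {X T : D} (η : K ⟶ sHom X T)
    (Y : D) [IsIso (tensorComparison η Y)] :
    Function.Bijective (transpose η : (T ⟶ Y) → (K ⟶ sHom X Y)) := by
  let e : (T ⟶ Y) ≃ (K ⟶ sHom X Y) :=
    (eHomEquiv SSet.{v}).trans
      (((asIso (tensorComparison η Y)).homToEquiv).trans
        (((ihom.adjunction K).homEquiv _ _).symm.trans ((ρ_ K).homFromEquiv)))
  have he : (transpose η : (T ⟶ Y) → (K ⟶ sHom X Y)) = e := by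
    funext g
    have h2 : MonoidalClosed.uncurry (eHomEquiv SSet.{v} g ≫ tensorComparison η Y) =
        K ◁ eHomEquiv SSet.{v} g ≫ η ▷ sHom T Y ≫ sHomComp X T Y := by
      rw [MonoidalClosed.uncurry_natural_left, tensorComparison, MonoidalClosed.uncurry_curry]
    have h1 : e g = (ρ_ K).inv ≫
        MonoidalClosed.uncurry (eHomEquiv SSet.{v} g ≫ tensorComparison η Y) := rfl
    rw [h1, h2, transpose, eHomWhiskerLeft, rightUnitor_inv_naturality_assoc,
      whisker_exchange_assoc]
  rw [he]
  exact e.bijective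

lemma eHomEquiv_comp_right {X Y Z : D} (f : X ⟶ Y) (g : Y ⟶ Z) :
    eHomEquiv SSet.{v} (f ≫ g) = eHomEquiv SSet.{v} f ≫ eHomWhiskerLeft SSet.{v} X g := by
  rw [eHomEquiv_comp, eHomWhiskerLeft, rightUnitor_inv_naturality_assoc, tensorHom_def_assoc,
    unitors_inv_equal]

lemma eHomEquiv_comp_left {X Y Z : D} (f : X ⟶ Y) (g : Y ⟶ Z) :
    eHomEquiv SSet.{v} (f ≫ g) = eHomEquiv SSet.{v} g ≫ eHomWhiskerRight SSet.{v} f Z := by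
  rw [eHomEquiv_comp, eHomWhiskerRight, leftUnitor_inv_naturality_assoc, tensorHom_def'_assoc]

end Simplicial

/-- A simplicial model category: a model category which is a simplicial category with tensors and
cotensors by finite simplicial sets and satisfies the axiom (SM7). Kan fibrations are the maps with
the right lifting property against horn inclusions, trivial Kan fibrations the ones with the
right lifting property against boundary inclusions. -/
class SimplicialModelCategory (D : Type u) [Category.{v} D] [ModelCategory D]
    [SimplicialCategory D] where
  /-- the tensor `X ⊗ K` -/
  tensor (K : SSet.{v}) [K.Finite] (X : D) : D
  tensorUnit (K : SSet.{v}) [K.Finite] (X : D) : K ⟶ sHom X (tensor K X)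
  isIso_tensorComparison (K : SSet.{v}) [K.Finite] (X Y : D) :
    IsIso (tensorComparison (tensorUnit K X) Y)
  /-- the cotensor `Y ^ K` -/
  cotensor (K : SSet.{v}) [K.Finite] (Y : D) : D
  cotensorCounit (K : SSet.{v}) [K.Finite] (Y : D) : K ⟶ sHom (cotensor K Y) Y
  isIso_cotensorComparison (K : SSet.{v}) [K.Finite] (X Y : D) :
    IsIso (cotensorComparison (cotensorCounit K Y) X)
  kanFibration_pullbackHom {A B X Y : D} (i : A ⟶ B) (p : X ⟶ Y) [Cofibration i] [Fibration p] :
    SSet.modelCategoryQuillen.J.rlp (pullbackHom i p)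
  trivialKanFibration_pullbackHom {A B X Y : D} (i : A ⟶ B) (p : X ⟶ Y) [Cofibration i]
    [Fibration p] (h : WeakEquivalence i ∨ WeakEquivalence p) :
    SSet.modelCategoryQuillen.I.rlp (pullbackHom i p)

attribute [instance] SimplicialModelCategory.isIso_tensorComparison
  SimplicialModelCategory.isIso_cotensorComparison

/-- Left and right properness of a model category. -/
class ProperModelCategory (D : Type u) [Category.{v} D] [ModelCategory D] : Prop where
  weakEquivalence_of_isPushout {A B X Y : D} {f : A ⟶ X} {i : A ⟶ B} {j : X ⟶ Y} {g : B ⟶ Y}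
    (sq : IsPushout f i j g) [Cofibration i] [WeakEquivalence f] : WeakEquivalence g
  weakEquivalence_of_isPullback {A B X Y : D} {f : A ⟶ X} {q : A ⟶ B} {p : X ⟶ Y} {g : B ⟶ Y}
    (sq : IsPullback f q p g) [Fibration p] [WeakEquivalence g] : WeakEquivalence f

/-! ### Cylinders and cones -/

section Cone

open scoped Simplicial

variable {D : Type u} [Category.{v} D] [ModelCategory D] [SimplicialCategory D]
  [SimplicialModelCategory D]

/-- The cylinder `X ⊗ I`, where `I = Δ[1]`. -/
noncomputable def cyl (X : D) : D := SimplicialModelCategory.tensor (Δ[1] : SSet.{v}) X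

/-- The universal map `Δ[1] ⟶ sHom X (X ⊗ I)`. -/
noncomputable def cylUnit (X : D) : (Δ[1] : SSet.{v}) ⟶ sHom X (cyl X) :=
  SimplicialModelCategory.tensorUnit (Δ[1] : SSet.{v}) X

lemma cyl_bijective (X Y : D) :
    Function.Bijective (transpose (cylUnit X) : (cyl X ⟶ Y) → _) :=
  haveI : IsIso (tensorComparison (cylUnit X) Y) :=
    SimplicialModelCategory.isIso_tensorComparison (Δ[1] : SSet.{v}) X Y
  transpose_bijective (cylUnit X) Y

lemma cyl_hom_ext {X Y : D} {g h : cyl X ⟶ Y}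
    (w : transpose (cylUnit X) g = transpose (cylUnit X) h) : g = h :=
  (cyl_bijective X Y).1 w

/-- The map `f ⊗ I`, characterized by compatibility with the universal maps. -/
noncomputable def cylMap {X Y : D} (f : X ⟶ Y) : cyl X ⟶ cyl Y :=
  ((cyl_bijective X (cyl Y)).2 (cylUnit Y ≫ eHomWhiskerRight SSet.{v} f (cyl Y))).choose

lemma transpose_cylMap {X Y : D} (f : X ⟶ Y) :
    transpose (cylUnit X) (cylMap f) = cylUnit Y ≫ eHomWhiskerRight SSet.{v} f (cyl Y) :=
  ((cyl_bijective X (cyl Y)).2 (cylUnit Y ≫ eHomWhiskerRight SSet.{v} f (cyl Y))).choose_spec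

variable (D) in
/-- The functorial cylinder `X ↦ X ⊗ I`. -/
noncomputable def cylFunctor : D ⥤ D where
  obj := cyl
  map := cylMap
  map_id X := cyl_hom_ext (by rw [transpose_cylMap]; simp [transpose])
  map_comp {X Y Z} f g := cyl_hom_ext (by
    rw [transpose_cylMap, transpose, eHomWhiskerLeft_comp, ← Category.assoc]
    change _ = transpose (cylUnit X) (cylMap f) ≫ _
    rw [transpose_cylMap, eHomWhiskerRight_comp, Category.assoc, ← eHom_whisker_exchange,
      ← Category.assoc, ← Category.assoc]
    congr 1
    exact (transpose_cylMap g).symm)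

/-- The vertex `e` of `Δ[1]`. -/
noncomputable def vertex (e : Fin 2) : 𝟙_ SSet.{v} ⟶ (Δ[1] : SSet.{v}) :=
  (SSet.unitHomEquiv _).symm (SSet.stdSimplex.obj₀Equiv.symm e)

/-- The inclusion `i_e : X ⟶ X ⊗ I` of the end `e` of the cylinder. -/
noncomputable def cylι (e : Fin 2) (X : D) : X ⟶ cyl X :=
  (eHomEquiv SSet.{v}).symm (vertex e ≫ cylUnit X)

lemma cylι_naturality (e : Fin 2) {X Y : D} (f : X ⟶ Y) :
    f ≫ cylι e Y = cylι e X ≫ cylMap f := by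
  apply (eHomEquiv SSet.{v}).injective
  rw [eHomEquiv_comp_left, eHomEquiv_comp_right, cylι, cylι, Equiv.apply_symm_apply,
    Equiv.apply_symm_apply, Category.assoc, Category.assoc, ← transpose_cylMap]
  rfl

variable [HasZeroMorphisms D]

variable (D) in
/-- The cone functor: `C X` is the strict cofiber (the cokernel) of `i_1 : X ⟶ X ⊗ I`. -/
noncomputable def cone : D ⥤ D where
  obj X := cokernel (cylι 1 X)
  map {X Y} f := cokernel.map _ _ f (cylMap f) (cylι_naturality 1 f).symm
  map_id X := by
    have : cylMap (𝟙 X) = 𝟙 _ := (cylFunctor D).map_id X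
    apply coequalizer.hom_ext
    simp [cokernel.map, this]
  map_comp f g := by
    have : cylMap (f ≫ g) = cylMap f ≫ cylMap g := (cylFunctor D).map_comp f g
    apply coequalizer.hom_ext
    simp [cokernel.map, this]

variable (D) in
/-- The inclusion `i^X : X ⟶ C X`, induced by `i_0 : X ⟶ X ⊗ I`. -/
noncomputable def coneι : 𝟭 D ⟶ cone D where
  app X := cylι 0 X ≫ cokernel.π (cylι 1 X)
  naturality X Y f := by
    change f ≫ cylι 0 Y ≫ cokernel.π (cylι 1 Y) =
      (cylι 0 X ≫ cokernel.π (cylι 1 X)) ≫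
        cokernel.map _ _ f (cylMap f) (cylι_naturality 1 f).symm
    rw [← Category.assoc, cylι_naturality]
    simp [cokernel.map]

end Cone
variable {D : Type u} [Category.{v} D]

/-! ### Cubes -/

/-- The binary sequences of length `n`. -/
def Cube : ℕ → Type
  | 0 => Unit
  | n + 1 => Bool × Cube n

namespace Cube

/-- Binary sequences are ordered coordinatewise. -/
instance instPartialOrder : ∀ n, PartialOrder (Cube n)
  | 0 => inferInstanceAs (PartialOrder Unit)
  | n + 1 => letI := instPartialOrder n; inferInstanceAs (PartialOrder (Bool × Cube n))

instance instFintype : ∀ n, Fintype (Cube n)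
  | 0 => inferInstanceAs (Fintype Unit)
  | n + 1 => letI := instFintype n; inferInstanceAs (Fintype (Bool × Cube n))

/-- The sequence `(1, …, 1)`. -/
def top : ∀ n, Cube n
  | 0 => ()
  | n + 1 => (true, top n)

lemma le_top : ∀ {n : ℕ} (a : Cube n), a ≤ top n
  | 0, _ => le_refl _
  | _ + 1, (b, r) => ⟨Bool.le_true b, le_top r⟩

end Cube

lemma not_true_le_false : ¬ (true ≤ false) := by decide

/-- The `(n+1)`-cube given by a map `τ : P ⟶ Q` of `n`-cubes: its faces `a₁ = 0` and `a₁ = 1` are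
`P` and `Q`, and `τ` gives the edges in the first direction. -/
def consCube {n : ℕ} {P Q : Cube n ⥤ D} (τ : P ⟶ Q) : Cube (n + 1) ⥤ D where
  obj
    | (false, r) => P.obj r
    | (true, r) => Q.obj r
  map {a b} f := match a, b, f with
    | (false, _), (false, _), f => P.map (homOfLE f.le.2)
    | (false, _), (true, r'), f => P.map (homOfLE f.le.2) ≫ τ.app r'
    | (true, _), (true, _), f => Q.map (homOfLE f.le.2)
    | (true, _), (false, _), f => absurd f.le.1 not_true_le_false
  map_id := by
    rintro ⟨_ | _, r⟩
    · exact P.map_id r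
    · exact Q.map_id r
  map_comp := by
    rintro ⟨_ | _, a⟩ ⟨_ | _, b⟩ ⟨_ | _, c⟩ f g
    · exact P.map_comp (homOfLE f.le.2) (homOfLE g.le.2)
    · change P.map _ ≫ τ.app c = P.map (homOfLE f.le.2) ≫ P.map (homOfLE g.le.2) ≫ τ.app c
      rw [← Category.assoc, ← P.map_comp]
      rfl
    · exact absurd g.le.1 not_true_le_false
    · change P.map _ ≫ τ.app c = (P.map (homOfLE f.le.2) ≫ τ.app b) ≫ Q.map (homOfLE g.le.2)
      rw [Category.assoc, ← τ.naturality, ← Category.assoc, ← P.map_comp]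
      rfl
    · exact absurd f.le.1 not_true_le_false
    · exact absurd f.le.1 not_true_le_false
    · exact absurd g.le.1 not_true_le_false
    · exact Q.map_comp (homOfLE f.le.2) (homOfLE g.le.2)

/-- The map of `(n+1)`-cubes given by a commutative square of maps of `n`-cubes. -/
def consCubeHom {n : ℕ} {P Q P' Q' : Cube n ⥤ D} {τ : P ⟶ Q} {τ' : P' ⟶ Q'}
    (α : P ⟶ P') (β : Q ⟶ Q') (w : τ ≫ β = α ≫ τ') : consCube τ ⟶ consCube τ' where
  app
    | (false, r) => α.app r
    | (true, r) => β.app r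
  naturality := by
    rintro ⟨_ | _, a⟩ ⟨_ | _, b⟩ f
    · exact α.naturality (homOfLE f.le.2)
    · have := NatTrans.congr_app w b
      simp only [NatTrans.comp_app] at this
      change (P.map (homOfLE f.le.2) ≫ τ.app b) ≫ β.app b =
        α.app a ≫ P'.map (homOfLE f.le.2) ≫ τ'.app b
      rw [Category.assoc, this, α.naturality_assoc]
    · exact absurd f.le.1 not_true_le_false
    · exact β.naturality (homOfLE f.le.2)

lemma consCubeHom_ext {n : ℕ} {P Q : Cube n ⥤ D} {τ : P ⟶ Q} {R : Cube (n + 1) ⥤ D}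
    {φ ψ : consCube τ ⟶ R} (h₀ : ∀ r, φ.app (false, r) = ψ.app (false, r))
    (h₁ : ∀ r, φ.app (true, r) = ψ.app (true, r)) : φ = ψ := by
  ext ⟨_ | _, r⟩
  · exact h₀ r
  · exact h₁ r

variable [ModelCategory D] [SimplicialCategory D] [SimplicialModelCategory D] [HasZeroMorphisms D]

variable (D) in
/-- The iterated cone `C^k`, written as `C^(k+1) X = C^k (C X)`. -/
noncomputable def coneIter : ℕ → D ⥤ D
  | 0 => 𝟭 D
  | k + 1 => cone D ⋙ coneIter k

/-- For `T : D ⥤ D`, the functor `T` applied to the cube `ℂ^(m) X`, where `ℂ^(m) X` sends `a` to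
`C^(deg a) X`, the edge `a ⟶ b` in direction `j` being `C^(deg a - k) (i^(C^k X))` with `k` the
number of `1`s of `a` before the place `j`. Thus `ℂ^(m+1) X` is the cube in the first direction
given by `ℂ^(m) (i^X) : ℂ^(m) X ⟶ ℂ^(m) (C X)`. -/
noncomputable def coneCubeOf (T : D ⥤ D) : ∀ m, D ⥤ (Cube m ⥤ D)
  | 0 => T ⋙ Functor.const _
  | m + 1 =>
    { obj := fun X => consCube ((coneCubeOf T m).map ((coneι D).app X))
      map := fun f => consCubeHom ((coneCubeOf T m).map f) ((coneCubeOf T m).map ((cone D).map f))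
        (by rw [← Functor.map_comp, ← Functor.map_comp]
            exact congrArg _ ((coneι D).naturality f).symm)
      map_id := fun X => consCubeHom_ext
        (fun r => NatTrans.congr_app ((coneCubeOf T m).map_id X) r)
        (fun r => (NatTrans.congr_app (congrArg (coneCubeOf T m).map ((cone D).map_id X)) r).trans
          (NatTrans.congr_app ((coneCubeOf T m).map_id ((cone D).obj X)) r))
      map_comp := fun f g => consCubeHom_ext
        (fun r => NatTrans.congr_app ((coneCubeOf T m).map_comp f g) r)
        (fun r =>
          (NatTrans.congr_app (congrArg (coneCubeOf T m).map ((cone D).map_comp f g)) r).trans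
            (NatTrans.congr_app
              ((coneCubeOf T m).map_comp ((cone D).map f) ((cone D).map g)) r)) }

variable (D) in
/-- The cube functor `X ↦ ℂ^(m) X`. -/
noncomputable abbrev coneCube (m : ℕ) : D ⥤ (Cube m ⥤ D) := coneCubeOf (𝟭 D) m

variable (D) in
/-- The functor `X ↦ C ℂ^(m) X`, the cone of the cube `ℂ^(m) X`. -/
noncomputable abbrev coneConeCube (m : ℕ) : D ⥤ (Cube m ⥤ D) := coneCubeOf (cone D) m

variable (D) in
/-- The inclusion `ℂ^(m) X ⟶ C ℂ^(m) X`, given by the maps `i^(C^(deg a) X)`. -/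
noncomputable def coneCubeι : ∀ m, coneCube D m ⟶ coneConeCube D m
  | 0 => Functor.whiskerRight (coneι D) (Functor.const _)
  | m + 1 =>
    { app := fun X => consCubeHom ((coneCubeι m).app X) ((coneCubeι m).app ((cone D).obj X))
        ((coneCubeι m).naturality ((coneι D).app X))
      naturality := fun _ _ f => consCubeHom_ext
        (fun r => NatTrans.congr_app ((coneCubeι m).naturality f) r)
        (fun r => NatTrans.congr_app ((coneCubeι m).naturality ((cone D).map f)) r) }

/-- The face map `C^p (i^(C^q X)) : C^p (C^q X) ⟶ C^p (C (C^q X)) = C^(p+q+1) X`, that is,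
`δ_r : C^(k-1) X ⟶ C^k X` for `k = p + q + 1` and `r = q + 1`. -/
noncomputable def coface (p : ℕ) : ∀ (q : ℕ) (X : D),
    (coneIter D p).obj ((coneIter D q).obj X) ⟶ (coneIter D (p + q + 1)).obj X
  | 0, X => (coneIter D p).map ((coneι D).app X)
  | q + 1, X => coface p q ((cone D).obj X)

lemma coface_naturality (p : ℕ) : ∀ (q : ℕ) {X Y : D} (f : X ⟶ Y),
    (coneIter D p).map ((coneIter D q).map f) ≫ coface p q Y =
      coface p q X ≫ (coneIter D (p + q + 1)).map f
  | 0, X, Y, f => by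
    change (coneIter D p).map f ≫ (coneIter D p).map ((coneι D).app Y) =
      (coneIter D p).map ((coneι D).app X) ≫ (coneIter D p).map ((cone D).map f)
    rw [← Functor.map_comp, ← Functor.map_comp]
    exact congrArg _ ((coneι D).naturality f)
  | q + 1, _, _, f => coface_naturality p q ((cone D).map f)

/-! ### Cubical Toda systems -/

/-- An `m`-th order cubical Toda system over the linear diagram `X = (X_0 ⟶ X_1 ⟶ … ⟶ X_N)` of
length `N`: maps `F^(k)_j : C^k X_j ⟶ X_(j+k+1)` for `k ≤ m`, where `F^(0)_j` is the map
`X_j ⟶ X_(j+1)` of the diagram, such that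
`d_r (F^(k)_j) = F^(k-r)_(j+r) ∘ C^(k-r) (F^(r-1)_j)` for `1 ≤ r ≤ k ≤ m`
(in `faces`, `k = p + q + 1` and `r = q + 1`). -/
structure CubicalTodaSystem (m N : ℕ) (X : ComposableArrows D N) where
  F (k : ℕ) (hk : k ≤ m) (j t : Fin (N + 1)) (ht : (j : ℕ) + k + 1 = t) :
    (coneIter D k).obj (X.obj j) ⟶ X.obj t
  F_zero (j t : Fin (N + 1)) (ht : (j : ℕ) + 0 + 1 = t) :
    F 0 m.zero_le j t ht = X.map (homOfLE (Fin.le_def.2 (by lia)))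
  faces (p q : ℕ) (h : p + q + 1 ≤ m) (j u t : Fin (N + 1)) (hu : (j : ℕ) + q + 1 = u)
    (ht : (u : ℕ) + p + 1 = t) :
    coface p q (X.obj j) ≫ F (p + q + 1) h j t (by lia) =
      (coneIter D p).map (F q (by lia) j u hu) ≫ F p (by lia) u t ht

namespace CubicalTodaSystem

variable {n N : ℕ} {X : ComposableArrows D N} (S : CubicalTodaSystem n N X)

/-- A family of maps `G^(k) : C^k Y ⟶ X_(s+k)`, `k ≤ m`, with
`d_r (G^(k)) = F^(k-r)_(s+r-1) ∘ C^(k-r) (G^(r-1))`. The example to keep in mind is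
`Y = X_(s-1)` and `G^(k) = F^(k)_(s-1)`, see `row`. -/
structure Family (s : ℕ) (Y : D) (m : ℕ) (hm : m ≤ n + 1) where
  G (k : ℕ) (hk : k ≤ m) (t : Fin (N + 1)) (ht : s + k = t) :
    (coneIter D k).obj Y ⟶ X.obj t
  faces (p q : ℕ) (h : p + q + 1 ≤ m) (u t : Fin (N + 1)) (hu : s + q = u)
    (ht : (u : ℕ) + p + 1 = t) :
    coface p q Y ≫ G (p + q + 1) h t (by lia) =
      (coneIter D p).map (G q (by lia) u hu) ≫ S.F p (by lia) u t ht

namespace Family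

variable {S}

lemma ext' {s : ℕ} {Y : D} {m : ℕ} {hm : m ≤ n + 1} {G G' : S.Family s Y m hm}
    (h : ∀ k hk t ht, G.G k hk t ht = G'.G k hk t ht) : G = G' := by
  cases G
  cases G'
  congr
  funext k hk t ht
  exact h k hk t ht

/-- The map `G^(0) : Y ⟶ X_s`. -/
noncomputable def base {s : ℕ} {Y : D} {m : ℕ} {hm : m ≤ n + 1} (G : S.Family s Y m hm)
    (hs : s < N + 1) : Y ⟶ X.obj ⟨s, hs⟩ :=
  G.G 0 m.zero_le ⟨s, hs⟩ rfl

/-- Precomposition of a family with a map `g : Z ⟶ Y`. -/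
noncomputable def pull {s : ℕ} {Y Z : D} {m : ℕ} {hm : m ≤ n + 1} (g : Z ⟶ Y) (G : S.Family s Y m hm) :
    S.Family s Z m hm where
  G k hk t ht := (coneIter D k).map g ≫ G.G k hk t ht
  faces p q h u t hu ht := by
    rw [← Category.assoc, ← coface_naturality, Category.assoc, G.faces p q h u t hu ht,
      Functor.map_comp, Category.assoc]

/-- Forgetting the last map of a family. -/
noncomputable def restrict {s : ℕ} {Y : D} {m : ℕ} {hm : m + 1 ≤ n + 1} (G : S.Family s Y (m + 1) hm) :
    S.Family s Y m (by lia) where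
  G k hk t ht := G.G k (by lia) t ht
  faces p q h u t hu ht := G.faces p q (by lia) u t hu ht

/-- The maps `G^(k+1) : C^k (C Y) ⟶ X_(s+1+k)` of a family. -/
noncomputable def shift {s : ℕ} {Y : D} {m : ℕ} {hm : m + 1 ≤ n + 1} (G : S.Family s Y (m + 1) hm) :
    S.Family (s + 1) ((cone D).obj Y) m (by lia) where
  G k hk t ht := G.G (k + 1) (by lia) t (by lia)
  faces p q h u t hu ht := G.faces p (q + 1) (by lia) u t (by lia) ht

end Family

/-- The family `F^(k)_j`, `k ≤ m`. -/
noncomputable def row (j : ℕ) (hj : j < N + 1) (m : ℕ) (hm : m ≤ n) :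
    S.Family (j + 1) (X.obj ⟨j, hj⟩) m (by lia) where
  G k hk t ht := S.F k (by lia) ⟨j, hj⟩ t (by simp; lia)
  faces p q h u t hu ht := S.faces p q (by lia) ⟨j, hj⟩ u t (by simp; lia) ht

variable {S} in
lemma Family.shift_pull {s : ℕ} {Y : D} {m : ℕ} (hm : m ≤ n) (G : S.Family s Y (m + 1) (by lia))
    (hs : s < N + 1) :
    G.shift.pull ((coneι D).app Y) =
      (S.row s hs m hm).pull (G.base hs) :=
  Family.ext' fun k hk t ht => G.faces k 0 (by lia) ⟨s, hs⟩ t rfl (by simp; lia)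

/-- The cubes `M^m_s` and `x^m_(s+m+1)` of a cubical Toda system, see `stage`. -/
structure Stage (m s : ℕ) (hm : m ≤ n) where
  /-- the cube `M^m_s`, with `M^m_s (a) = C^(deg a - init a) X_(s + init a)` -/
  M : Cube m ⥤ D
  /-- the cube `x^m_(s+m+1)`, with value `X_(s+m+1)` at `(1, …, 1)` and `C M^m_s (a)` elsewhere -/
  x : Cube m ⥤ D
  /-- the cube map `M^m_s ⟶ x^m_(s+m+1)`: the cone inclusions, and the map
  `X_(s+m) ⟶ X_(s+m+1)` at `(1, …, 1)` -/
  B : M ⟶ x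
  /-- the cube map `ℂ^(m) Y ⟶ M^m_s` with components `C^(deg a - init a) G^(init a)` -/
  A {Y : D} (G : S.Family s Y m (by lia)) : (coneCube D m).obj Y ⟶ M
  /-- the cube map `C ℂ^(m) Y ⟶ x^m_(s+m+1)` with component `G^(m+1)` at `(1, …, 1)` and
  components `C^(deg a - init a + 1) G^(init a)` elsewhere -/
  Φ {Y : D} (G : S.Family s Y (m + 1) (by lia)) : (coneConeCube D m).obj Y ⟶ x
  A_pull {Y Z : D} (g : Z ⟶ Y) (G : S.Family s Y m (by lia)) :
    A (G.pull g) = (coneCube D m).map g ≫ A G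
  Φ_pull {Y Z : D} (g : Z ⟶ Y) (G : S.Family s Y (m + 1) (by lia)) :
    Φ (G.pull g) = (coneConeCube D m).map g ≫ Φ G
  A_B {Y : D} (G : S.Family s Y (m + 1) (by lia)) :
    A G.restrict ≫ B = (coneCubeι D m).app Y ≫ Φ G

/-- The cubes `M^m_s` and `x^m_(s+m+1)`, built along the first direction: the faces `a₁ = 0` and
`a₁ = 1` of `M^(m+1)_s` are `ℂ^(m) X_s` and `M^m_(s+1)`, and those of `x^(m+1)_(s+m+2)` are
`C ℂ^(m) X_s` and `x^m_(s+m+2)`. -/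
noncomputable def stage : ∀ (m s : ℕ) (hm : m ≤ n) (_ : s + m + 1 < N + 1), S.Stage m s hm
  | 0, s, _, hs =>
    { M := (Functor.const _).obj (X.obj ⟨s, by lia⟩)
      x := (Functor.const _).obj (X.obj ⟨s + 1, by lia⟩)
      B := (Functor.const _).map (S.F 0 n.zero_le ⟨s, by lia⟩ ⟨s + 1, by lia⟩ rfl)
      A := fun G => (Functor.const _).map (G.G 0 le_rfl ⟨s, by lia⟩ rfl)
      Φ := fun G => (Functor.const _).map (G.G 1 le_rfl ⟨s + 1, by lia⟩ rfl)
      A_pull := fun g G => (Functor.const _).map_comp g (G.G 0 le_rfl ⟨s, by lia⟩ rfl)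
      Φ_pull := fun g G =>
        (Functor.const _).map_comp ((cone D).map g) (G.G 1 le_rfl ⟨s + 1, by lia⟩ rfl)
      A_B := fun {Y} G => by
        have h := G.faces 0 0 le_rfl ⟨s, by lia⟩ ⟨s + 1, by lia⟩ rfl rfl
        exact congrArg (Functor.const (Cube 0)).map h.symm }
  | m + 1, s, hm, hs =>
    let Q := stage m (s + 1) (by lia) (by lia)
    let R := S.row s (by lia) (m + 1) hm
    { M := consCube (Q.A R.restrict)
      x := consCube (Q.Φ R)
      B := consCubeHom ((coneCubeι D m).app _) Q.B (Q.A_B R)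
      A := fun {Y} G => consCubeHom ((coneCube D m).map (G.base (by lia)))
        (Q.A G.shift) (by
          rw [← Q.A_pull]
          exact (congrArg Q.A (G.shift_pull (by lia) (by lia))).trans (Q.A_pull _ R.restrict))
      Φ := fun {Y} G => consCubeHom ((coneConeCube D m).map (G.base (by lia)))
        (Q.Φ G.shift) (by
          rw [← Q.Φ_pull]
          exact (congrArg Q.Φ (G.shift_pull (by lia) (by lia))).trans (Q.Φ_pull _ R))
      A_pull := fun g G => consCubeHom_ext
        (fun r => NatTrans.congr_app ((coneCube D m).map_comp g _) r)
        (fun r => NatTrans.congr_app (Q.A_pull ((cone D).map g) G.shift) r)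
      Φ_pull := fun g G => consCubeHom_ext
        (fun r => NatTrans.congr_app ((coneConeCube D m).map_comp g _) r)
        (fun r => NatTrans.congr_app (Q.Φ_pull ((cone D).map g) G.shift) r)
      A_B := fun G => consCubeHom_ext
        (fun r => NatTrans.congr_app
          ((coneCubeι D m).naturality (G.base (by lia))) r)
        (fun r => NatTrans.congr_app (Q.A_B G.shift) r) }

end CubicalTodaSystem

/-! ### Strongly cofibrant diagrams -/

/-- A diagram `A` indexed by a finite partially ordered set is strongly cofibrant if, for each
element `p`, the map `colim_{q < p} A q ⟶ A p` is a cofibration. (For minimal `p` this says that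
`A p` is cofibrant.) -/
def StronglyCofibrant {P : Type} [PartialOrder P] [Fintype P] (A : P ⥤ D) : Prop :=
  ∀ p : P,
    letI : Fintype {q : P // q < p} := Fintype.ofFinite _
    Cofibration (colimit.desc ((Subtype.mono_coe (fun q : P => q < p)).functor ⋙ A)
      { pt := A.obj p
        ι :=
          { app := fun q => A.map (homOfLE q.2.le)
            naturality := fun q q' f => by
              change A.map (homOfLE f.le) ≫ A.map (homOfLE q'.2.le) =
                A.map (homOfLE q.2.le) ≫ 𝟙 _
              rw [← A.map_comp, Category.comp_id]
              rfl } })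

/-- The partially ordered set `[2] × {0,1}^n`. -/
def ThreeCubes (n : ℕ) : Type := Fin 3 × Cube n

instance (n : ℕ) : PartialOrder (ThreeCubes n) := inferInstanceAs (PartialOrder (Fin 3 × Cube n))

instance (n : ℕ) : Fintype (ThreeCubes n) := inferInstanceAs (Fintype (Fin 3 × Cube n))

/-- A sequence of two maps of `n`-cubes, as a diagram indexed by `[2] × {0,1}^n`. -/
def threeCubes {n : ℕ} {P Q R : Cube n ⥤ D} (α : P ⟶ Q) (β : Q ⟶ R) : ThreeCubes n ⥤ D where
  obj a := ((ComposableArrows.mk₂ α β).obj a.1).obj a.2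
  map {a b} f := ((ComposableArrows.mk₂ α β).obj a.1).map (homOfLE f.le.2) ≫
    ((ComposableArrows.mk₂ α β).map (homOfLE f.le.1)).app b.2
  map_id a := by
    have h₁ := ((ComposableArrows.mk₂ α β).obj a.1).map_id a.2
    have h₂ := NatTrans.congr_app ((ComposableArrows.mk₂ α β).map_id a.1) a.2
    exact (congrArg₂ _ h₁ h₂).trans (Category.comp_id _)
  map_comp {a b c} f g := by
    have h₁ := ((ComposableArrows.mk₂ α β).obj a.1).map_comp (homOfLE f.le.2) (homOfLE g.le.2)
    have h₂ := NatTrans.congr_app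
      ((ComposableArrows.mk₂ α β).map_comp (homOfLE f.le.1) (homOfLE g.le.1)) c.2
    have h₃ := ((ComposableArrows.mk₂ α β).map (homOfLE f.le.1)).naturality (homOfLE g.le.2)
    refine (congrArg₂ _ h₁ h₂).trans ?_
    simp only [NatTrans.comp_app, Category.assoc]
    rw [reassoc_of% h₃]

/-- An `n`-th order cubical Toda system of length `n + 2` is strongly cofibrant if the diagram
`ℂ^(n) X_0 ⟶ M^n_1 ⟶ x^n_(n+2)` is (the objects of the linear diagram being numbered from `0`). -/
def CubicalTodaSystem.IsStronglyCofibrant {n : ℕ} {X : ComposableArrows D (n + 2)}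
    (S : CubicalTodaSystem n (n + 2) X) : Prop :=
  StronglyCofibrant (threeCubes
    ((S.stage n 1 le_rfl (by lia)).A (S.row 0 (by lia) n le_rfl))
    (S.stage n 1 le_rfl (by lia)).B)

/-! ### The Toda bracket -/

/-- The cocone over the cube in the first direction given by `τ : P ⟶ Q`, obtained from a cocone
over `Q`. -/
def consCubeDesc {n : ℕ} {P Q : Cube n ⥤ D} (τ : P ⟶ Q) {Z : D}
    (β : Q ⟶ (Functor.const _).obj Z) : consCube τ ⟶ (Functor.const _).obj Z where
  app
    | (false, r) => τ.app r ≫ β.app r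
    | (true, r) => β.app r
  naturality := by
    rintro ⟨_ | _, a⟩ ⟨_ | _, b⟩ f
    · exact (τ ≫ β).naturality (homOfLE f.le.2)
    · refine Eq.trans ?_ ((τ ≫ β).naturality (homOfLE f.le.2))
      exact Category.assoc _ _ _
    · exact absurd f.le.1 not_true_le_false
    · exact β.naturality (homOfLE f.le.2)

/-- The maps `ℂ^(m) Y (a) ⟶ ℂ^(m) Y (1, …, 1) = C^m Y` of the cube `ℂ^(m) Y`. -/
noncomputable def collapse : ∀ (m : ℕ) (Y : D),
    (coneCube D m).obj Y ⟶ (Functor.const _).obj ((coneIter D m).obj Y)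
  | 0, _ => 𝟙 _
  | m + 1, Y => consCubeDesc _ (collapse m ((cone D).obj Y))

lemma collapse_naturality : ∀ (m : ℕ) {Y Z : D} (g : Z ⟶ Y) (r : Cube m),
    ((coneCube D m).map g).app r ≫ (collapse m Y).app r =
      (collapse m Z).app r ≫ (coneIter D m).map g
  | 0, _, _, g, _ => (Category.comp_id g).trans (Category.id_comp g).symm
  | m + 1, Y, Z, g, (false, r) => by
    have h := collapse_naturality m ((cone D).map g) r
    have h' := NatTrans.congr_app
      (congrArg (coneCube D m).map ((coneι D).naturality g)) r
    rw [CategoryTheory.Functor.map_comp, CategoryTheory.Functor.map_comp] at h'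
    change ((coneCube D m).map g).app r ≫ ((coneCube D m).map ((coneι D).app Y)).app r ≫
      (collapse m ((cone D).obj Y)).app r = (((coneCube D m).map ((coneι D).app Z)).app r ≫
      (collapse m ((cone D).obj Z)).app r) ≫ (coneIter D m).map ((cone D).map g)
    rw [Category.assoc, ← h, ← Category.assoc, ← Category.assoc]
    exact congrArg (· ≫ _) h'
  | m + 1, _, _, g, (true, r) => collapse_naturality m ((cone D).map g) r

namespace CubicalTodaSystem

variable {n N : ℕ} {X : ComposableArrows D N} (S : CubicalTodaSystem n N X)

/-- The map `C^m Y ⟶ X_(s+m+1)` given by `F^(m)_s ∘ C^m (G^(0))`. -/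
noncomputable def firstLeg (m s : ℕ) {Y : D} (hm : m ≤ n) (G : S.Family s Y m (by lia))
    (t : Fin (N + 1)) (ht : s + m + 1 = t) : (coneIter D m).obj Y ⟶ X.obj t :=
  (coneIter D m).map (G.base (by lia)) ≫ S.F m hm ⟨s, by lia⟩ t ht

/-- The maps `ℂ^(m+1) Y (a) ⟶ X_(s+m+1)` for `a ≠ (1, …, 1)`: if the first `0` of `a` is in the
place `k`, then the map is the map `ℂ^(m+1) Y (a) ⟶ ℂ^(m+1) Y (r_k) = C^m Y`, where `r_k` is the
sequence with a single `0` in the place `k`, followed by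
`F^(m-k+1)_(s+k-1) ∘ C^(m-k+1) (G^(k-1)) : C^m Y ⟶ X_(s+m+1)`. -/
noncomputable def leg : ∀ (m s : ℕ) {Y : D} (hm : m ≤ n) (_ : S.Family s Y m (by lia))
    (t : Fin (N + 1)) (_ : s + m + 1 = t) (a : Cube (m + 1)), a ≠ Cube.top (m + 1) →
    (((coneCube D (m + 1)).obj Y).obj a ⟶ X.obj t)
  | 0, s, Y, hm, G, t, ht => fun
    | (false, r), _ => (collapse 0 Y).app r ≫ S.firstLeg 0 s hm G t ht
    | (true, _), h => absurd rfl h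
  | m + 1, s, Y, hm, G, t, ht => fun
    | (false, r), _ => (collapse (m + 1) Y).app r ≫ S.firstLeg (m + 1) s hm G t ht
    | (true, r), h =>
      leg m (s + 1) (by lia) G.shift t (by lia) r (fun hr => h (congrArg (Prod.mk true) hr))

lemma leg_false (m s : ℕ) {Y : D} (hm : m ≤ n) (G : S.Family s Y m (by lia))
    (t : Fin (N + 1)) (ht : s + m + 1 = t) (r : Cube m) (h) :
    S.leg m s hm G t ht (false, r) h = (collapse m Y).app r ≫ S.firstLeg m s hm G t ht := by
  cases m <;> rfl

lemma firstLeg_pull (m s : ℕ) {Y Z : D} (g : Z ⟶ Y) (hm : m ≤ n)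
    (G : S.Family s Y m (by lia)) (t : Fin (N + 1)) (ht : s + m + 1 = t) :
    S.firstLeg m s hm (G.pull g) t ht = (coneIter D m).map g ≫ S.firstLeg m s hm G t ht :=
  (congrArg (· ≫ _) ((coneIter D m).map_comp g (G.base (by lia)))).trans (Category.assoc _ _ _)

lemma leg_pull : ∀ (m s : ℕ) {Y Z : D} (g : Z ⟶ Y) (hm : m ≤ n) (G : S.Family s Y m (by lia))
    (t : Fin (N + 1)) (ht : s + m + 1 = t) (a : Cube (m + 1)) (ha : a ≠ Cube.top (m + 1)),
    S.leg m s hm (G.pull g) t ht a ha =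
      ((coneCube D (m + 1)).map g).app a ≫ S.leg m s hm G t ht a ha
  | m, s, Y, Z, g, hm, G, t, ht, (false, r), _ => by
    rw [leg_false, leg_false, firstLeg_pull]
    refine Eq.trans ?_ (Category.assoc _ _ _)
    refine (Category.assoc _ _ _).symm.trans ?_
    exact congrArg (· ≫ _) (collapse_naturality m g r).symm
  | 0, _, _, _, _, _, _, _, _, (true, _), h => absurd rfl h
  | m + 1, s, _, _, g, _, G, t, ht, (true, r), h =>
    leg_pull m (s + 1) ((cone D).map g) (by lia) G.shift t (by lia) r
      (fun hr => h (congrArg (Prod.mk true) hr))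

lemma firstLeg_eq (m s : ℕ) {Y : D} (hm : m ≤ n) (G : S.Family s Y (m + 1) (by lia))
    (t : Fin (N + 1)) (ht : s + m + 1 = t) :
    S.firstLeg m s hm G.restrict t ht =
      (coneIter D m).map ((coneι D).app Y) ≫ G.G (m + 1) le_rfl t (by lia) :=
  (G.faces m 0 le_rfl ⟨s, by lia⟩ t rfl (by simp; lia)).symm

lemma leg_restrict : ∀ (m s : ℕ) {Y : D} (hm : m ≤ n) (G : S.Family s Y (m + 1) (by lia))
    (t : Fin (N + 1)) (ht : s + m + 1 = t) (a : Cube (m + 1)) (ha : a ≠ Cube.top (m + 1)),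
    S.leg m s hm G.restrict t ht a ha =
      (collapse (m + 1) Y).app a ≫ G.G (m + 1) le_rfl t (by lia)
  | m, s, Y, hm, G, t, ht, (false, r), _ => by
    rw [leg_false, firstLeg_eq]
    refine (Category.assoc _ _ _).symm.trans ?_
    exact congrArg (· ≫ _) (collapse_naturality m ((coneι D).app Y) r).symm
  | 0, _, _, _, _, _, _, (true, _), h => absurd rfl h
  | m + 1, s, _, _, G, t, ht, (true, r), h =>
    leg_restrict m (s + 1) (by lia) G.shift t (by lia) r
      (fun hr => h (congrArg (Prod.mk true) hr))

lemma leg_naturality : ∀ (m s : ℕ) {Y : D} (hm : m ≤ n) (G : S.Family s Y m (by lia))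
    (t : Fin (N + 1)) (ht : s + m + 1 = t) (a b : Cube (m + 1)) (f : a ⟶ b)
    (ha : a ≠ Cube.top (m + 1)) (hb : b ≠ Cube.top (m + 1)),
    ((coneCube D (m + 1)).obj Y).map f ≫ S.leg m s hm G t ht b hb = S.leg m s hm G t ht a ha
  | m, s, Y, hm, G, t, ht, (false, r), (false, r'), f, _, _ => by
    rw [leg_false, leg_false]
    refine (Category.assoc _ _ _).symm.trans ?_
    refine congrArg (· ≫ _) (((collapse m Y).naturality (homOfLE f.le.2)).trans ?_)
    exact Category.comp_id _
  | _, _, _, _, _, _, _, (true, _), (false, _), f, _, _ => absurd f.le.1 not_true_le_false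
  | 0, _, _, _, _, _, _, _, (true, _), _, _, h => absurd rfl h
  | m + 1, s, Y, hm, G, t, ht, (false, r), (true, r'), f, _, hb => by
    have hr' : r' ≠ Cube.top (m + 1) := fun hr => hb (congrArg (Prod.mk true) hr)
    have h₁ := S.leg_pull m (s + 1) ((coneι D).app Y) (by lia) G.shift t (by lia) r' hr'
    have h₂ := congrArg (fun G' => S.leg m (s + 1) (by lia) G' t (by lia) r' hr')
      (G.shift_pull (by lia) (by lia))
    have h₃ := S.leg_pull m (s + 1) (G.base (by lia)) (by lia)
      (S.row s (by lia) m (by lia)) t (by lia) r' hr'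
    have h₄ := S.leg_restrict m (s + 1) (by lia) (S.row s (by lia) (m + 1) hm) t (by lia) r' hr'
    have h₅ := collapse_naturality (m + 1) (G.base (by lia)) r'
    have h₆ := (collapse (m + 1) Y).naturality (homOfLE f.le.2)
    rw [leg_false]
    have h₇ : ((coneCube D (m + 1)).map ((coneι D).app Y)).app r' ≫
        S.leg m (s + 1) (by lia) G.shift t (by lia) r' hr' =
        (collapse (m + 1) Y).app r' ≫ S.firstLeg (m + 1) s hm G t ht := by
      refine h₁.symm.trans (h₂.trans (h₃.trans ?_))
      refine (congrArg (_ ≫ ·) h₄).trans ?_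
      refine (Category.assoc _ _ _).symm.trans ?_
      refine (congrArg (· ≫ _) h₅).trans ?_
      exact Category.assoc _ _ _
    refine (Category.assoc _ _ _).trans ?_
    refine (congrArg (_ ≫ ·) h₇).trans ?_
    refine (Category.assoc _ _ _).symm.trans ?_
    exact congrArg (· ≫ _) (h₆.trans (Category.comp_id _))
  | m + 1, s, Y, hm, G, t, ht, (true, r), (true, r'), f, _, _ =>
    leg_naturality m (s + 1) (by lia) G.shift t (by lia) r r' (homOfLE f.le.2) _ _

end CubicalTodaSystem

/-- The partially ordered set of the binary sequences of length `n + 1` other than `(1, …, 1)`. -/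
abbrev PuncturedCube (n : ℕ) : Type := {a : Cube (n + 1) // a ≠ Cube.top (n + 1)}

noncomputable instance (n : ℕ) : Fintype (PuncturedCube n) := Fintype.ofFinite _

/-- The restriction `𝕃^(n) Y` of the cube `ℂ^(n+1) Y` to the sequences other than `(1, …, 1)`. -/
noncomputable def puncturedConeCube (n : ℕ) (Y : D) : PuncturedCube n ⥤ D :=
  (Subtype.mono_coe (fun a : Cube (n + 1) => a ≠ Cube.top (n + 1))).functor ⋙
    (coneCube D (n + 1)).obj Y

/-- The colimit `L^n Y` of `𝕃^(n) Y`. -/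
noncomputable def L (n : ℕ) (Y : D) : D := colimit (puncturedConeCube n Y)

/-- The value `T : L^n X_0 ⟶ X_(n+2)` of the Toda bracket of an `n`-th order cubical Toda system of
length `n + 2` (the objects of the linear diagram being numbered from `0`): the map whose
restriction to `𝕃^(n) X_0 (r_k) = C^n X_0` is `F^(n-k+1)_k ∘ C^(n-k+1) (F^(k-1)_0)`, for
`1 ≤ k ≤ n + 1`, where `r_k` is the sequence with a single `0` in the place `k`. -/
noncomputable def CubicalTodaSystem.todaBracket {n : ℕ} {X : ComposableArrows D (n + 2)}
    (S : CubicalTodaSystem n (n + 2) X) :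
    L n (X.obj ⟨0, by lia⟩) ⟶ X.obj ⟨n + 2, by lia⟩ :=
  colimit.desc (puncturedConeCube n (X.obj ⟨0, by lia⟩))
    { pt := X.obj ⟨n + 2, by lia⟩
      ι :=
        { app := fun a =>
            S.leg n 1 le_rfl (S.row 0 (by lia) n le_rfl) ⟨n + 2, by lia⟩ (by simp; lia) a.1 a.2
          naturality := fun a b f =>
            (S.leg_naturality n 1 le_rfl _ _ _ a.1 b.1 (homOfLE f.le) a.2 b.2).trans
              (Category.comp_id _).symm } }

/-! ### Nullhomotopic maps and rectifications -/

/-- A map is nullhomotopic if it becomes zero in the homotopy category `Ho D`. -/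
def IsNullhomotopic {Y Z : D} (f : Y ⟶ Z) : Prop :=
  (weakEquivalences D).Q.map f = (weakEquivalences D).Q.map 0

/-- Two linear diagrams are weakly equivalent if they are connected by a zigzag of natural
transformations which are objectwise weak equivalences. -/
def WeaklyEquivalent {N : ℕ} (X X' : ComposableArrows D N) : Prop :=
  Relation.EqvGen (fun A B : ComposableArrows D N => ∃ φ : A ⟶ B, ∀ i, WeakEquivalence (φ.app i))
    X X'

/-- A linear diagram is rectifiable if it is weakly equivalent to a linear diagram in which the
composite of any two successive maps is zero. -/
def IsRectifiable {N : ℕ} (X : ComposableArrows D N) : Prop :=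
  ∃ X' : ComposableArrows D N, WeaklyEquivalent X X' ∧
    ∀ (i : ℕ) (hi : i + 2 ≤ N), X'.map' i (i + 1) ≫ X'.map' (i + 1) (i + 2) = 0

end Toda

/-! The bracket is the obstruction to adding one more map of top order to the system; once that map
exists, every obstruction to strictifying the diagram is gone.

Number the objects from 0. Replace `X_0` by a cofibrant object and `X_(n+2)` by a fibrant one, and
call the new objects `U_i`. The boundary inclusion `L^n U_0 ⟶ C^(n+1) U_0` is a cofibration between
cofibrant objects (`cofibration_boundaryι`, `isCofibrant_L`), so the nullhomotopic bracket,
transported to `U_0` and `U_(n+2)`, extends by homotopy extension to a map `F^(n+1)_0 : C^(n+1) U_0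
⟶ U_(n+2)`. Its faces are the prescribed composites. Padding with zero maps beyond the index `n + 2`
gives a system of maps of all orders on a sequence indexed by `ℕ` (`exists_coneSystem`), which
removes all bounds from the rest of the argument.

Such a system is strictified by a tower. Start with `W_0 = 0`. Given a coherent family `C^m W_k ⟶
U_(k+m)`, factor `W_k ⟶ U_k` as a cofibration `W_k ⟶ X̃_k` followed by a trivial fibration, and let
`W_(k+1) = X̃_k ∪_(W_k) C W_k`, the homotopy cofiber. The face relations say exactly that the family
on `C W_k` and the maps out of `X̃_k` agree on `W_k`; since `C` preserves pushouts they glue to a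
family on `W_(k+1)`. The composite `X̃_k ⟶ W_(k+1) ⟶ X̃_(k+1)` covers `U_k ⟶ U_(k+1)`.

The composite of two successive maps factors through `V_(k+2) = C W_(k+1)`, which is contractible
and included in `X̃_(k+2)` by a cofibration. Dividing each `X̃_k` by `V_k` is a weak equivalence by
left properness, and makes these composites strictly zero (`strictMap_strictMap`). -/

namespace Toda

/-! ### Maps out of cones -/

section Cotransposes

variable {D : Type u} [Category.{v} D] [SimplicialCategory D]

/-- Precomposing `ε : K ⟶ sHom P Y` with a morphism `X ⟶ P`. -/
noncomputable def cotranspose {K : SSet.{v}} {P Y : D} (ε : K ⟶ sHom P Y) {X : D} (g : X ⟶ P) :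
    K ⟶ sHom X Y :=
  ε ≫ eHomWhiskerRight SSet.{v} g Y

/-- Morphisms `X ⟶ P` are the points of `sHom X P`. The comparison isomorphism turns them into
points of the internal hom, that is, into maps `K ⟶ sHom X Y`; it remains to identify this bijection
with `cotranspose`. -/
lemma cotranspose_bijective {K : SSet.{v}} {P Y : D} (ε : K ⟶ sHom P Y)
    (X : D) [IsIso (cotensorComparison ε X)] :
    Function.Bijective (cotranspose ε : (X ⟶ P) → (K ⟶ sHom X Y)) := by
  let e : (X ⟶ P) ≃ (K ⟶ sHom X Y) :=
    (eHomEquiv SSet.{v}).trans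
      (((asIso (cotensorComparison ε X)).homToEquiv).trans
        (((ihom.adjunction K).homEquiv _ _).symm.trans ((ρ_ K).homFromEquiv)))
  have he : (cotranspose ε : (X ⟶ P) → (K ⟶ sHom X Y)) = e := by
    funext g
    have h2 : MonoidalClosed.uncurry (eHomEquiv SSet.{v} g ≫ cotensorComparison ε X) =
        K ◁ eHomEquiv SSet.{v} g ≫ (β_ K (sHom X P)).hom ≫ sHom X P ◁ ε ≫ sHomComp X P Y := by
      rw [MonoidalClosed.uncurry_natural_left, cotensorComparison, MonoidalClosed.uncurry_curry]
    have h1 : e g = (ρ_ K).inv ≫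
        MonoidalClosed.uncurry (eHomEquiv SSet.{v} g ≫ cotensorComparison ε X) := rfl
    rw [h1, h2, cotranspose, eHomWhiskerRight, leftUnitor_inv_naturality_assoc,
      BraidedCategory.braiding_naturality_right_assoc, ← whisker_exchange_assoc,
      whisker_exchange_assoc]
    simp
  rw [he]
  exact e.bijective

end Cotransposes

section Cones

open scoped Simplicial

variable {D : Type u} [Category.{v} D] [ModelCategory D] [SimplicialCategory D]
  [SimplicialModelCategory D]

/-- The evaluation at the vertex `1` on the path object `Y ^ Δ[1]`. -/
noncomputable def pathEval (Y : D) : SimplicialModelCategory.cotensor (Δ[1] : SSet.{v}) Y ⟶ Y :=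
  (eHomEquiv SSet.{v}).symm
    (vertex 1 ≫ SimplicialModelCategory.cotensorCounit (Δ[1] : SSet.{v}) Y)

lemma vertex_cotranspose {X Y : D} (g : X ⟶ SimplicialModelCategory.cotensor (Δ[1] : SSet.{v}) Y) :
    vertex 1 ≫ cotranspose (SimplicialModelCategory.cotensorCounit (Δ[1] : SSet.{v}) Y) g =
      eHomEquiv SSet.{v} (g ≫ pathEval Y) := by
  rw [eHomEquiv_comp_left, pathEval, Equiv.apply_symm_apply, Category.assoc]
  rfl

lemma vertex_transpose (e : Fin 2) {X Y : D} (g : cyl X ⟶ Y) :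
    vertex e ≫ transpose (cylUnit X) g = eHomEquiv SSet.{v} (cylι e X ≫ g) := by
  rw [eHomEquiv_comp_right, cylι, Equiv.apply_symm_apply, Category.assoc]
  rfl

variable [HasZeroMorphisms D]

/-- The projection `X ⊗ I ⟶ C X`. -/
noncomputable def coneπ (X : D) : cyl X ⟶ (cone D).obj X := cokernel.π (cylι 1 X)

instance (X : D) : Epi (coneπ X) := inferInstanceAs (Epi (cokernel.π (cylι 1 X)))

lemma cylι_one_coneπ (X : D) : cylι 1 X ≫ coneπ X = 0 := cokernel.condition _

lemma cylι_zero_coneπ (X : D) : cylι 0 X ≫ coneπ X = (coneι D).app X := rfl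

lemma coneπ_map {X Y : D} (f : X ⟶ Y) : coneπ X ≫ (cone D).map f = cylMap f ≫ coneπ Y :=
  cokernel.π_desc _ _ _

lemma exists_coneπ_comp_eq {X Y : D} (g : cyl X ⟶ Y) (h : cylι 1 X ≫ g = 0) :
    ∃ g' : (cone D).obj X ⟶ Y, coneπ X ≫ g' = g :=
  ⟨cokernel.desc _ g h, cokernel.π_desc _ _ _⟩

/-- The map `Δ[1] ⟶ sHom X Y` which corresponds to a map out of the cone of `X`. -/
noncomputable def coneTranspose {X Y : D} (g : (cone D).obj X ⟶ Y) :
    (Δ[1] : SSet.{v}) ⟶ sHom X Y :=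
  transpose (cylUnit X) (coneπ X ≫ g)

lemma vertex_one_coneTranspose {X Y : D} (g : (cone D).obj X ⟶ Y) :
    vertex 1 ≫ coneTranspose g = eHomEquiv SSet.{v} 0 := by
  rw [coneTranspose, vertex_transpose, reassoc_of% cylι_one_coneπ X, zero_comp]

lemma vertex_zero_coneTranspose {X Y : D} (g : (cone D).obj X ⟶ Y) :
    vertex 0 ≫ coneTranspose g = eHomEquiv SSet.{v} ((coneι D).app X ≫ g) := by
  rw [coneTranspose, vertex_transpose, reassoc_of% cylι_zero_coneπ X]

lemma coneTranspose_injective {X Y : D} :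
    Function.Injective (coneTranspose : ((cone D).obj X ⟶ Y) → _) := fun _ _ w =>
  (cancel_epi (coneπ X)).1 (cyl_hom_ext w)

lemma exists_coneTranspose_eq {X Y : D} (φ : (Δ[1] : SSet.{v}) ⟶ sHom X Y)
    (h : vertex 1 ≫ φ = eHomEquiv SSet.{v} 0) :
    ∃ g : (cone D).obj X ⟶ Y, coneTranspose g = φ := by
  obtain ⟨g, rfl⟩ := (cyl_bijective X Y).2 φ
  rw [vertex_transpose] at h
  obtain ⟨g', hg⟩ := exists_coneπ_comp_eq g ((eHomEquiv SSet.{v}).injective h)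
  exact ⟨g', congrArg (transpose (cylUnit X)) hg⟩

lemma coneTranspose_comp {X Y Z : D} (g : (cone D).obj X ⟶ Y) (h : Y ⟶ Z) :
    coneTranspose (g ≫ h) = coneTranspose g ≫ eHomWhiskerLeft SSet.{v} X h := by
  rw [coneTranspose, coneTranspose, transpose, transpose, ← Category.assoc (coneπ X),
    eHomWhiskerLeft_comp, Category.assoc]

lemma coneTranspose_map_comp {X Y Z : D} (f : X ⟶ Y) (g : (cone D).obj Y ⟶ Z) :
    coneTranspose ((cone D).map f ≫ g) = coneTranspose g ≫ eHomWhiskerRight SSet.{v} f Z := by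
  rw [coneTranspose, reassoc_of% coneπ_map f, transpose, eHomWhiskerLeft_comp, ← Category.assoc]
  change transpose (cylUnit X) (cylMap f) ≫ _ = _
  rw [transpose_cylMap, Category.assoc, ← eHom_whisker_exchange, ← Category.assoc]
  rfl

/-- The transposes of maps out of a cone. -/
noncomputable def coneTransposeEquiv (X Y : D) : ((cone D).obj X ⟶ Y) ≃
    {φ : (Δ[1] : SSet.{v}) ⟶ sHom X Y // vertex 1 ≫ φ = eHomEquiv SSet.{v} 0} :=
  Equiv.ofBijective (fun g => ⟨coneTranspose g, vertex_one_coneTranspose g⟩)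
    ⟨fun _ _ w => coneTranspose_injective (congrArg Subtype.val w), fun φ =>
      (exists_coneTranspose_eq φ.1 φ.2).imp fun _ hg => Subtype.ext hg⟩

/-- The transposes of maps into the based path object. -/
noncomputable def pathTransposeEquiv (X Y : D) : (X ⟶ kernel (pathEval Y)) ≃
    {φ : (Δ[1] : SSet.{v}) ⟶ sHom X Y // vertex 1 ≫ φ = eHomEquiv SSet.{v} 0} := by
  have hb := cotranspose_bijective
    (SimplicialModelCategory.cotensorCounit (Δ[1] : SSet.{v}) Y) X
  refine Equiv.ofBijective (fun g => ⟨cotranspose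
    (SimplicialModelCategory.cotensorCounit (Δ[1] : SSet.{v}) Y) (g ≫ kernel.ι _), ?_⟩) ⟨?_, ?_⟩
  · rw [vertex_cotranspose, Category.assoc, kernel.condition, comp_zero]
  · intro g h w
    exact (cancel_mono (kernel.ι _)).1 (hb.1 (congrArg Subtype.val w))
  · rintro ⟨φ, hφ⟩
    obtain ⟨g, rfl⟩ := hb.2 φ
    rw [vertex_cotranspose] at hφ
    exact ⟨kernel.lift _ g ((eHomEquiv SSet.{v}).injective hφ),
      Subtype.ext (congrArg (cotranspose _) (kernel.lift_ι _ _ _))⟩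

lemma coneHomEquiv_naturality {X' X Y : D} (f : X' ⟶ X) (g : (cone D).obj X ⟶ Y) :
    ((coneTransposeEquiv X' Y).trans (pathTransposeEquiv X' Y).symm) ((cone D).map f ≫ g) =
      f ≫ ((coneTransposeEquiv X Y).trans (pathTransposeEquiv X Y).symm) g := by
  simp only [Equiv.trans_apply, Equiv.symm_apply_eq]
  have h := (pathTransposeEquiv X Y).apply_symm_apply (coneTransposeEquiv X Y g)
  generalize (pathTransposeEquiv X Y).symm (coneTransposeEquiv X Y g) = g' at h ⊢
  have h' : cotranspose _ (g' ≫ kernel.ι _) = coneTranspose g := congrArg Subtype.val h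
  apply Subtype.ext
  change coneTranspose ((cone D).map f ≫ g) = cotranspose _ ((f ≫ g') ≫ kernel.ι _)
  rw [coneTranspose_map_comp, ← h', Category.assoc]
  simp only [cotranspose, eHomWhiskerRight_comp, Category.assoc]

/-- Maps out of `C X` and maps from `X` to the based path object `kernel (pathEval Y)` are both the
edges of `sHom X Y` whose vertex `1` is the zero map. The adjunction is needed because it makes
cones preserve pushouts and initial objects. -/
instance : (cone D).IsLeftAdjoint :=
  (Adjunction.adjunctionOfEquivRight
    (fun X Y => (coneTransposeEquiv X Y).trans (pathTransposeEquiv X Y).symm)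
    fun _ _ _ f g => coneHomEquiv_naturality f g).isLeftAdjoint

instance coneIter_isLeftAdjoint (k : ℕ) : (coneIter D k).IsLeftAdjoint := by
  induction k with
  | zero => exact inferInstanceAs (𝟭 D).IsLeftAdjoint
  | succ k ih => exact inferInstanceAs (cone D ⋙ coneIter D k).IsLeftAdjoint

end Cones

end Toda

namespace Toda

/-! ### Lifting edges of simplicial sets -/

section Edges

open scoped Simplicial

/-- The map from the discrete simplicial set with two points to `Z` given by two vertices. -/
def ofVertices {Z : SSet.{v}} (x : Fin 2 → (𝟙_ SSet.{v} ⟶ Z)) :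
    (Functor.const SimplexCategoryᵒᵖ).obj (ULift.{v} (Fin 2)) ⟶ Z where
  app k := ↾fun e => (x e.down).app k PUnit.unit
  naturality k l f := by
    ext e
    exact ConcreteCategory.congr_hom ((x e.down).naturality f) PUnit.unit

lemma ofVertices_comp {Z Z' : SSet.{v}} (x : Fin 2 → (𝟙_ SSet.{v} ⟶ Z)) (f : Z ⟶ Z') :
    ofVertices x ≫ f = ofVertices (fun e => x e ≫ f) := rfl

lemma vertex_eq_of_ofVertices_eq {Z : SSet.{v}} {x y : Fin 2 → (𝟙_ SSet.{v} ⟶ Z)}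
    (h : ofVertices x = ofVertices y) (e : Fin 2) : x e = y e := by
  ext k ⟨⟩
  exact ConcreteCategory.congr_hom (NatTrans.congr_app h k) ⟨e⟩

instance : Mono (ofVertices (vertex.{v})) := by
  have (k : SimplexCategoryᵒᵖ) : Mono ((ofVertices (vertex.{v})).app k) := by
    rw [mono_iff_injective]
    rintro ⟨e⟩ ⟨e'⟩ h
    -- The degenerate simplex on the vertex `e` is the constant map `e`, so its value at `0`
    -- recovers `e`.
    have h' : ∀ e, SSet.stdSimplex.objEquiv ((vertex.{v} e).app k PUnit.unit) 0 = e := by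
      intro e
      rfl
    have h'' : e = e' := by
      rw [← h' e, ← h' e']
      exact congrArg (fun s : (Δ[1] : SSet.{v}).obj k => SSet.stdSimplex.objEquiv s 0) h
    rw [h'']
  exact NatTrans.mono_of_mono_app _

/-- Trivial Kan fibrations lift against all monomorphisms, in particular against the inclusion of
both ends of `Δ[1]`. -/
lemma exists_lift_edge_of_trivialKanFibration {Z Z' : SSet.{v}} (p : Z ⟶ Z')
    (hp : SSet.modelCategoryQuillen.I.rlp p) (x : Fin 2 → (𝟙_ SSet.{v} ⟶ Z))
    (φ : (Δ[1] : SSet.{v}) ⟶ Z') (h : ∀ e, vertex e ≫ φ = x e ≫ p) :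
    ∃ ψ : (Δ[1] : SSet.{v}) ⟶ Z, (∀ e, vertex e ≫ ψ = x e) ∧ ψ ≫ p = φ := by
  rw [← SSet.rlp_monomorphisms] at hp
  have := hp (ofVertices vertex) (inferInstanceAs (Mono _))
  have sq : CommSq (ofVertices x) (ofVertices vertex) p φ :=
    ⟨by rw [ofVertices_comp, ofVertices_comp]; exact congrArg _ (funext fun e => (h e).symm)⟩
  exact ⟨sq.lift, fun e => vertex_eq_of_ofVertices_eq (x := fun e => vertex e ≫ sq.lift)
    ((ofVertices_comp _ _).symm.trans sq.fac_left) e, sq.fac_right⟩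

/-- The horn `Λ[1, 1]` is the single vertex `1` of `Δ[1]`, so horn filling lifts edges with that end
prescribed. -/
lemma exists_lift_edge_of_kanFibration {Z Z' : SSet.{v}} (p : Z ⟶ Z')
    (hp : SSet.modelCategoryQuillen.J.rlp p) (x : 𝟙_ SSet.{v} ⟶ Z)
    (φ : (Δ[1] : SSet.{v}) ⟶ Z') (h : vertex 1 ≫ φ = x ≫ p) :
    ∃ ψ : (Δ[1] : SSet.{v}) ⟶ Z, vertex 1 ≫ ψ = x ∧ ψ ≫ p = φ := by
  have := hp _ (SSet.modelCategoryQuillen.horn_ι_mem_J 1 1)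
  have hv : vertex.{v} 1 = (SSet.unitHomEquiv _).symm (SSet.stdSimplex.obj₀Equiv.symm 0) ≫
      SSet.horn.ι (n := 0) 1 0 (by decide) ≫ (SSet.horn 1 1).ι := by
    rw [SSet.horn.ι_ι]
    ext k ⟨⟩
    rw [SSet.stdSimplex.δ_zero_eq_const]
    rfl
  have sq : CommSq (SemiCartesianMonoidalCategory.toUnit _ ≫ x) (SSet.horn 1 1).ι p φ := ⟨by
    apply SSet.horn.hom_ext
    intro j hj
    obtain rfl : j = 0 := by lia
    have h₁ := ConcreteCategory.congr_hom (NatTrans.congr_app h (Opposite.op ⦋0⦌)) PUnit.unit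
    have h₂ : (SSet.horn.face.{v} (n := 0) 1 0 hj).1 =
        (vertex.{v} 1).app (Opposite.op ⦋0⦌) PUnit.unit :=
      SSet.stdSimplex.objEquiv.injective (by ext i; fin_cases i; rfl)
    exact h₁.symm.trans (congrArg (fun s => φ.app (Opposite.op ⦋0⦌) s) h₂.symm)⟩
  refine ⟨sq.lift, ?_, sq.fac_right⟩
  rw [hv, Category.assoc, Category.assoc, sq.fac_left, ← Category.assoc, ← Category.assoc]
  convert Category.id_comp x
  subsingleton

end Edges

end Toda

namespace Toda

/-! ### Cones and cofibrations -/

lemma cofibration_of_hasLiftingProperty {D : Type u} [Category.{v} D] [ModelCategory D] {A B : D} (f : A ⟶ B)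
    (h : ∀ {E E' : D} (p : E ⟶ E') [Fibration p] [WeakEquivalence p], HasLiftingProperty f p) :
    Cofibration f := by
  rw [cofibration_iff, ← trivialFibrations_llp]
  intro E E' p hp
  obtain ⟨_, _⟩ := (mem_trivialFibrations_iff p).1 hp
  exact h p

section ConeLifting

open scoped Simplicial

variable {D : Type u} [Category.{v} D] [ModelCategory D] [SimplicialCategory D]
  [SimplicialModelCategory D] [HasZeroMorphisms D]

section

variable {A B E E' : D} (f : A ⟶ B) (p : E ⟶ E') (a : (cone D).obj A ⟶ E)
  (c : (cone D).obj B ⟶ E') (h : (cone D).map f ≫ c = a ≫ p)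

/-- The edge given by a square from `C f` to `p`. -/
noncomputable def coneSquareEdge :
    (Δ[1] : SSet.{v}) ⟶ pullback (eHomWhiskerLeft SSet.{v} A p) (eHomWhiskerRight SSet.{v} f E') :=
  pullback.lift (coneTranspose a) (coneTranspose c)
    (by rw [← coneTranspose_comp, ← coneTranspose_map_comp, h])

/-- The zero map `B ⟶ E` always lifts the end `1`. Hence lifting problems for cones reduce to
lifting edges with that end prescribed, and with the end `0` prescribed as well when a map on the
base of the cone is given. -/
lemma vertex_one_coneSquareEdge :
    vertex 1 ≫ coneSquareEdge f p a c h = eHomEquiv SSet.{v} 0 ≫ pullbackHom f p := by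
  apply pullback.hom_ext
  · simp only [coneSquareEdge, pullbackHom, Category.assoc, pullback.lift_fst]
    rw [vertex_one_coneTranspose, ← eHomEquiv_comp_left, comp_zero]
  · simp only [coneSquareEdge, pullbackHom, Category.assoc, pullback.lift_snd]
    rw [vertex_one_coneTranspose, ← eHomEquiv_comp_right, zero_comp]

lemma vertex_zero_coneSquareEdge (b : B ⟶ E) (h₁ : (coneι D).app A ≫ a = f ≫ b)
    (h₂ : (coneι D).app B ≫ c = b ≫ p) :
    vertex 0 ≫ coneSquareEdge f p a c h = eHomEquiv SSet.{v} b ≫ pullbackHom f p := by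
  apply pullback.hom_ext
  · simp only [coneSquareEdge, pullbackHom, Category.assoc, pullback.lift_fst]
    rw [vertex_zero_coneTranspose, ← eHomEquiv_comp_left, h₁]
  · simp only [coneSquareEdge, pullbackHom, Category.assoc, pullback.lift_snd]
    rw [vertex_zero_coneTranspose, ← eHomEquiv_comp_right, h₂]

lemma exists_cone_lift_of_edge (ψ : (Δ[1] : SSet.{v}) ⟶ sHom B E)
    (hψ : vertex 1 ≫ ψ = eHomEquiv SSet.{v} 0)
    (hψ' : ψ ≫ pullbackHom f p = coneSquareEdge f p a c h) :
    ∃ l : (cone D).obj B ⟶ E, coneTranspose l = ψ ∧ (cone D).map f ≫ l = a ∧ l ≫ p = c := by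
  obtain ⟨l, rfl⟩ := exists_coneTranspose_eq ψ hψ
  refine ⟨l, rfl, coneTranspose_injective ?_, coneTranspose_injective ?_⟩
  · have := congrArg (· ≫ pullback.fst _ _) hψ'
    simp only [coneSquareEdge, pullbackHom, Category.assoc, pullback.lift_fst] at this
    rw [coneTranspose_map_comp, this]
  · have := congrArg (· ≫ pullback.snd _ _) hψ'
    simp only [coneSquareEdge, pullbackHom, Category.assoc, pullback.lift_snd] at this
    rw [coneTranspose_comp, this]

end

/-- Lifting in the corner of a square of cones against a trivial fibration. -/
lemma exists_cone_corner_lift {A B E E' : D} (f : A ⟶ B) [Cofibration f] (p : E ⟶ E')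
    [Fibration p] [WeakEquivalence p] (a : (cone D).obj A ⟶ E) (b : B ⟶ E)
    (c : (cone D).obj B ⟶ E') (h : (cone D).map f ≫ c = a ≫ p)
    (h₁ : (coneι D).app A ≫ a = f ≫ b) (h₂ : (coneι D).app B ≫ c = b ≫ p) :
    ∃ l : (cone D).obj B ⟶ E,
      (coneι D).app B ≫ l = b ∧ (cone D).map f ≫ l = a ∧ l ≫ p = c := by
  obtain ⟨ψ, hψ, hψ'⟩ := exists_lift_edge_of_trivialKanFibration _
    (SimplicialModelCategory.trivialKanFibration_pullbackHom f p (.inr inferInstance))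
    ![eHomEquiv SSet.{v} b, eHomEquiv SSet.{v} 0] (coneSquareEdge f p a c h) (fun e => by
      fin_cases e
      · exact vertex_zero_coneSquareEdge f p a c h b h₁ h₂
      · exact vertex_one_coneSquareEdge f p a c h)
  obtain ⟨l, rfl, hl⟩ := exists_cone_lift_of_edge f p a c h ψ (hψ 1) hψ'
  refine ⟨l, (eHomEquiv SSet.{v}).injective ?_, hl⟩
  rw [← vertex_zero_coneTranspose]
  exact hψ 0

/-- If `f : A ⟶ B` is a cofibration, then so is the map `C A ∪_A B ⟶ C B`. -/
lemma cofibration_coneCorner {A B P : D} (f : A ⟶ B) [Cofibration f] {inl : (cone D).obj A ⟶ P}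
    {inr : B ⟶ P} (sq : IsPushout ((coneι D).app A) f inl inr) :
    Cofibration (sq.desc ((cone D).map f) ((coneι D).app B) ((coneι D).naturality f).symm) := by
  refine cofibration_of_hasLiftingProperty _ fun p _ _ => ⟨fun {s t} w => ?_⟩
  obtain ⟨l, h₁, h₂, h₃⟩ := exists_cone_corner_lift f p (inl ≫ s) (inr ≫ s) t
    (by rw [Category.assoc, w.w, sq.inl_desc_assoc])
    (by rw [reassoc_of% sq.w]) (by rw [Category.assoc, w.w, sq.inr_desc_assoc])
  exact ⟨⟨l, sq.hom_ext (by rw [sq.inl_desc_assoc, h₂]) (by rw [sq.inr_desc_assoc, h₁]), h₃⟩⟩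

/-- The cone of a cofibration is a trivial cofibration. -/
lemma trivialCofibrations_cone_map {A B : D} (f : A ⟶ B) [Cofibration f] :
    trivialCofibrations D ((cone D).map f) := by
  rw [← fibrations_llp]
  intro E E' p hp
  rw [← fibration_iff] at hp
  refine ⟨fun {a c} w => ?_⟩
  -- Nothing is prescribed on the base `B` of the cone, so only the end `1` is fixed and `p` need
  -- not be a weak equivalence.
  obtain ⟨ψ, hψ, hψ'⟩ := exists_lift_edge_of_kanFibration _
    (SimplicialModelCategory.kanFibration_pullbackHom f p) _ _
    (vertex_one_coneSquareEdge f p a c w.w.symm)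
  obtain ⟨l, -, hl⟩ := exists_cone_lift_of_edge f p a c w.w.symm ψ hψ hψ'
  exact ⟨⟨l, hl.1, hl.2⟩⟩

instance {A B : D} (f : A ⟶ B) [Cofibration f] : Cofibration ((cone D).map f) := by
  rw [cofibration_iff]
  exact (trivialCofibrations_cone_map f).1

instance {A B : D} (f : A ⟶ B) [Cofibration f] : WeakEquivalence ((cone D).map f) := by
  rw [weakEquivalence_iff]
  exact (trivialCofibrations_cone_map f).2

end ConeLifting

end Toda

namespace Toda

/-! ### Lifting properties of cubes of cones -/

section Faces

variable {D : Type u} [Category.{v} D]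

/-- Prefixing a binary sequence. -/
abbrev Cube.cons {n : ℕ} (b : Bool) (r : Cube n) : Cube (n + 1) := (b, r)

lemma Cube.cons_false_le {n : ℕ} (r : Cube n) : Cube.cons false r ≤ Cube.cons true r :=
  ⟨Bool.false_le true, le_rfl⟩

/-- The inclusion of a face in the first direction. -/
def faceInclusion (n : ℕ) (b : Bool) : Cube n ⥤ Cube (n + 1) :=
  Monotone.functor (f := Cube.cons b) fun _ _ h => ⟨le_rfl, h⟩

/-- The edge in the first direction. -/
def Cube.edge {n : ℕ} (r : Cube n) : Cube.cons false r ⟶ Cube.cons true r :=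
  homOfLE (Cube.cons_false_le r)

/-- The map between the faces of a cube in the first direction. -/
def faceMap {n : ℕ} (E : Cube (n + 1) ⥤ D) :
    faceInclusion n false ⋙ E ⟶ faceInclusion n true ⋙ E where
  app r := E.map (Cube.edge r)
  naturality _ _ _ := by
    refine (E.map_comp _ _).symm.trans (Eq.trans ?_ (E.map_comp _ _))
    rfl

/-- A map of cubes whose source is given by a map between its faces in the first direction. -/
def consCubeToHom {n : ℕ} {P Q : Cube n ⥤ D} {τ : P ⟶ Q} {E : Cube (n + 1) ⥤ D}
    (α : P ⟶ faceInclusion n false ⋙ E) (β : Q ⟶ faceInclusion n true ⋙ E)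
    (w : τ ≫ β = α ≫ faceMap E) : consCube τ ⟶ E where
  app
    | (false, r) => α.app r
    | (true, r) => β.app r
  naturality := by
    rintro ⟨_ | _, a⟩ ⟨_ | _, b⟩ f
    · exact α.naturality (homOfLE f.le.2)
    · have h : τ.app b ≫ β.app b = α.app b ≫ (faceMap E).app b := NatTrans.congr_app w b
      have h' : P.map (homOfLE f.le.2) ≫ α.app b = α.app a ≫ E.map _ :=
        α.naturality (homOfLE f.le.2)
      change (P.map (homOfLE f.le.2) ≫ τ.app b) ≫ β.app b = α.app a ≫ E.map f
      rw [Category.assoc, h, reassoc_of% h']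
      exact congrArg _ (E.map_comp _ _).symm
    · exact absurd f.le.1 not_true_le_false
    · exact β.naturality (homOfLE f.le.2)

lemma consCube_face_condition {n : ℕ} {P Q : Cube n ⥤ D} {τ : P ⟶ Q} {E : Cube (n + 1) ⥤ D}
    (φ : consCube τ ⟶ E) (r : Cube n) :
    τ.app r ≫ φ.app (true, r) = φ.app (false, r) ≫ (faceMap E).app r := by
  refine Eq.trans ?_ (φ.naturality (Cube.edge r))
  change _ = (P.map (𝟙 r) ≫ τ.app r) ≫ _
  rw [P.map_id, Category.id_comp]

/-- The restriction of a map of cubes to the face `a₁ = 0`. -/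
def consCubeFaceZero {n : ℕ} {P Q : Cube n ⥤ D} {τ : P ⟶ Q} {E : Cube (n + 1) ⥤ D}
    (φ : consCube τ ⟶ E) : P ⟶ faceInclusion n false ⋙ E where
  app r := φ.app (false, r)
  naturality _ _ f := φ.naturality ((faceInclusion n false).map f)

/-- The restriction of a map of cubes to the face `a₁ = 1`. -/
def consCubeFaceOne {n : ℕ} {P Q : Cube n ⥤ D} {τ : P ⟶ Q} {E : Cube (n + 1) ⥤ D}
    (φ : consCube τ ⟶ E) : Q ⟶ faceInclusion n true ⋙ E where
  app r := φ.app (true, r)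
  naturality _ _ f := φ.naturality ((faceInclusion n true).map f)

end Faces

variable {D : Type u} [Category.{v} D] [ModelCategory D] [SimplicialCategory D]
  [SimplicialModelCategory D] [HasZeroMorphisms D]

/-- Colimits of cubes are computed at each vertex, and there the functor is an iterated cone
followed by `T`. -/
instance preservesColimitsOfShape_coneCubeOf (J : Type) [SmallCategory J] (T : D ⥤ D)
    [PreservesColimitsOfShape J T] (m : ℕ) : PreservesColimitsOfShape J (coneCubeOf T m) := by
  suffices h : ∀ (m : ℕ) (a : Cube m),
      PreservesColimitsOfShape J (coneCubeOf T m ⋙ (evaluation (Cube m) D).obj a) from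
    preservesColimitsOfShape_of_evaluation _ _ (h m)
  intro m
  induction m with
  | zero => exact fun _ => inferInstanceAs (PreservesColimitsOfShape J T)
  | succ m ih =>
    rintro ⟨_ | _, r⟩
    · exact ih r
    · have := ih r
      exact inferInstanceAs (PreservesColimitsOfShape J
        (cone D ⋙ coneCubeOf T m ⋙ (evaluation (Cube m) D).obj r))

/-- If `f` is a cofibration, then `ℂ^(m) f` has the left lifting property with respect to the maps
of cubes which are objectwise trivial fibrations. -/
lemma hasLiftingProperty_coneCube_map (m : ℕ) {A B : D} (f : A ⟶ B) [Cofibration f]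
    {E E' : Cube m ⥤ D} (p : E ⟶ E') (hp : ∀ a, Fibration (p.app a))
    (hp' : ∀ a, WeakEquivalence (p.app a)) : HasLiftingProperty ((coneCube D m).map f) p := by
  induction m generalizing A B with
  | zero =>
    refine ⟨fun {s t} sq => ?_⟩
    have := hp ()
    have := hp' ()
    have : HasLiftingProperty f (p.app ()) := ModelCategory.cm4b f (p.app ())
    let s' : A ⟶ E.obj () := s.app ()
    let t' : B ⟶ E'.obj () := t.app ()
    have sq' : CommSq s' f (p.app ()) t' := ⟨NatTrans.congr_app sq.w ()⟩
    exact ⟨⟨{ app := fun _ => sq'.lift, naturality := fun _ _ _ => by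
                refine (Category.id_comp _).trans ((Category.comp_id _).symm.trans ?_)
                exact congrArg (sq'.lift ≫ ·) (E.map_id ()).symm },
      by ext; exact sq'.fac_left, by ext; exact sq'.fac_right⟩⟩
  | succ m ih =>
    refine ⟨fun {s t} sq => ?_⟩
    let s' : consCube ((coneCube D m).map ((coneι D).app A)) ⟶ E := s
    let t' : consCube ((coneCube D m).map ((coneι D).app B)) ⟶ E' := t
    have := ih f (Functor.whiskerLeft (faceInclusion m false) p) (fun r => hp (false, r))
      (fun r => hp' (false, r))
    have sq₀ : CommSq (consCubeFaceZero s') ((coneCube D m).map f)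
        (Functor.whiskerLeft (faceInclusion m false) p) (consCubeFaceZero t') :=
      ⟨by ext r; exact NatTrans.congr_app sq.w (false, r)⟩
    -- On the face `a₁ = 1` the lift is prescribed twice: on `ℂ^(m) (C A)` by `s`, and on `ℂ^(m) B`
    -- by the lift already found on `a₁ = 0`. Since `ℂ^(m)` preserves the pushout `C A ∪_A B`, this
    -- is the induction hypothesis for the corner map into `C B`.
    have hP := IsPushout.of_hasPushout ((coneι D).app A) f
    have := cofibration_coneCorner f hP
    have := ih (hP.desc ((cone D).map f) ((coneι D).app B) ((coneι D).naturality f).symm)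
      (Functor.whiskerLeft (faceInclusion m true) p) (fun r => hp (true, r))
      (fun r => hp' (true, r))
    have hP' := hP.map (coneCube D m)
    have w : (coneCube D m).map ((coneι D).app A) ≫ consCubeFaceOne s' =
        (coneCube D m).map f ≫ sq₀.lift ≫ faceMap E := by
      rw [sq₀.fac_left_assoc]
      ext r
      exact consCube_face_condition s' r
    have sq₁ : CommSq (hP'.desc _ _ w)
        ((coneCube D m).map (hP.desc ((cone D).map f) ((coneι D).app B)
          ((coneι D).naturality f).symm))
        (Functor.whiskerLeft (faceInclusion m true) p) (consCubeFaceOne t') := ⟨by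
      apply hP'.hom_ext
      · rw [hP'.inl_desc_assoc, ← Functor.map_comp_assoc, hP.inl_desc]
        ext r
        exact NatTrans.congr_app sq.w (true, r)
      · rw [hP'.inr_desc_assoc, ← Functor.map_comp_assoc, hP.inr_desc]
        have h₁ : faceMap E ≫ Functor.whiskerLeft (faceInclusion m true) p =
            Functor.whiskerLeft (faceInclusion m false) p ≫ faceMap E' := by
          ext r
          exact p.naturality (Cube.edge r)
        rw [Category.assoc, h₁, sq₀.fac_right_assoc]
        ext r
        exact (consCube_face_condition t' r).symm⟩
    obtain ⟨l, hl, hl'⟩ : ∃ l, (coneCube D m).map (hP.desc ((cone D).map f) ((coneι D).app B)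
        ((coneι D).naturality f).symm) ≫ l = hP'.desc _ _ w ∧
        l ≫ Functor.whiskerLeft (faceInclusion m true) p = consCubeFaceOne t' :=
      ⟨sq₁.lift, sq₁.fac_left, sq₁.fac_right⟩
    have h₂ : (coneCube D m).map ((coneι D).app B) ≫ l = sq₀.lift ≫ faceMap E := by
      refine Eq.trans ?_ (hP'.inr_desc _ _ w)
      rw [← hl, ← Functor.map_comp_assoc, hP.inr_desc]
    have h₃ : (coneCube D m).map ((cone D).map f) ≫ l = consCubeFaceOne s' := by
      refine Eq.trans ?_ (hP'.inl_desc _ _ w)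
      rw [← hl, ← Functor.map_comp_assoc, hP.inl_desc]
    refine ⟨⟨consCubeToHom sq₀.lift l h₂, ?_, ?_⟩⟩
    · exact consCubeHom_ext (fun r => NatTrans.congr_app sq₀.fac_left r)
        (fun r => NatTrans.congr_app h₃ r)
    · exact consCubeHom_ext (fun r => NatTrans.congr_app sq₀.fac_right r)
        (fun r => NatTrans.congr_app hl' r)

end Toda

namespace Toda

/-! ### Cubes which are constant away from the last vertex -/

section TopCube

variable {D : Type u} [Category.{v} D]

lemma Cube.eq_top_of_top_le : ∀ {n : ℕ} {a : Cube n}, Cube.top n ≤ a → a = Cube.top n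
  | _, _, h => le_antisymm (Cube.le_top _) h

open scoped Classical in
/-- The monotone map which detects the last vertex of a cube. -/
noncomputable def Cube.topIndex (m : ℕ) (a : Cube m) : Fin 2 := if a = Cube.top m then 1 else 0

lemma Cube.topIndex_monotone (m : ℕ) : Monotone (Cube.topIndex m) := by
  intro a b h
  unfold Cube.topIndex
  split_ifs with h₁ h₂
  · exact le_rfl
  · subst h₁
    exact absurd (Cube.eq_top_of_top_le h) h₂
  · exact Fin.zero_le _
  · exact le_rfl

lemma Cube.topIndex_of_ne {m : ℕ} {a : Cube m} (h : a ≠ Cube.top m) : Cube.topIndex m a = 0 :=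
  if_neg h

lemma Cube.ne_of_topIndex {m : ℕ} {a : Cube m} (h : Cube.topIndex m a = 0) : a ≠ Cube.top m := by
  rintro rfl
  rw [Cube.topIndex, if_pos rfl] at h
  exact absurd h (by decide)

variable {U V U' V' : D} (u : U ⟶ V) {u' : U' ⟶ V'}

/-- The values `U` and `V` of the arrow `u : U ⟶ V`. -/
abbrev arrowObj (i : Fin 2) : D := (ComposableArrows.mk₁ u).obj i

/-- The projection of a value of the arrow `u` to `U`, for the index `0`. -/
def arrowOut (i : Fin 2) (h : i = 0) : arrowObj u i ⟶ U := eqToHom (by subst h; rfl)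

variable {u} in
/-- A map to a value of the arrow `u`. -/
def arrowIn {Z : D} : ∀ (i : Fin 2) (_ : i = 0 → (Z ⟶ U)) (_ : Z ⟶ V), Z ⟶ arrowObj u i
  | 0, α, _ => α rfl
  | 1, _, β => β

/-- The map from a value of the arrow `u` to `V`. -/
def arrowToEnd (i : Fin 2) : arrowObj u i ⟶ V :=
  (ComposableArrows.mk₁ u).map (homOfLE (Fin.le_last i) : i ⟶ 1)

lemma arrowToEnd_naturality (i j : Fin 2) (f : i ⟶ j) :
    (ComposableArrows.mk₁ u).map f ≫ arrowToEnd u j = arrowToEnd u i :=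
  ((ComposableArrows.mk₁ u).map_comp _ _).symm

lemma arrowIn_toEnd {Z : D} (i : Fin 2) (α : i = 0 → (Z ⟶ U)) (β : Z ⟶ V)
    (h : ∀ h, α h ≫ u = β) : arrowIn (u := u) i α β ≫ arrowToEnd u i = β := by
  fin_cases i
  · exact h rfl
  · exact Category.comp_id _

lemma arrowOut_comp (i : Fin 2) (h : i = 0) : arrowOut u i h ≫ u = arrowToEnd u i := by
  subst h
  exact Category.id_comp _

variable {u} in
/-- The map of arrows given by a commutative square. -/
def arrowMap (a : U ⟶ U') (b : V ⟶ V') (w : u ≫ b = a ≫ u') :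
    ComposableArrows.mk₁ u ⟶ ComposableArrows.mk₁ u' :=
  ComposableArrows.homMk₁ a b w

lemma arrowIn_out {Z : D} (i : Fin 2) (α : i = 0 → (Z ⟶ U)) (β : Z ⟶ V) (h : i = 0) :
    arrowIn (u := u) i α β ≫ arrowOut u i h = α h := by
  subst h
  exact Category.comp_id _

lemma arrowIn_naturality {Z Z' : D} (g : Z ⟶ Z') (i j : Fin 2) (f : i ⟶ j)
    (α : i = 0 → (Z ⟶ U)) (β : Z ⟶ V) (α' : j = 0 → (Z' ⟶ U)) (β' : Z' ⟶ V)
    (hα : ∀ h h', g ≫ α' h = α h') (hβ : g ≫ β' = β) (h : ∀ h, α h ≫ u = β) :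
    g ≫ arrowIn (u := u) j α' β' = arrowIn i α β ≫ (ComposableArrows.mk₁ u).map f := by
  fin_cases i <;> fin_cases j
  · exact (hα rfl rfl).trans (Category.comp_id _).symm
  · exact hβ.trans (h rfl).symm
  · exact absurd f.le (by decide)
  · exact hβ.trans (Category.comp_id _).symm

lemma arrowOut_naturality (i j : Fin 2) (f : i ⟶ j) (hi : i = 0) (hj : j = 0) :
    (ComposableArrows.mk₁ u).map f ≫ arrowOut u j hj = arrowOut u i hi := by
  subst hi hj
  exact Category.comp_id _

variable {u} in
lemma arrowMap_out (a : U ⟶ U') (b : V ⟶ V') (w : u ≫ b = a ≫ u') (i : Fin 2)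
    (h : i = 0) : (arrowMap a b w).app i ≫ arrowOut u' i h = arrowOut u i h ≫ a := by
  subst h
  exact (Category.comp_id _).trans (Category.id_comp _).symm

variable {u} in
lemma arrowMap_toEnd (a : U ⟶ U') (b : V ⟶ V') (w : u ≫ b = a ≫ u') (i : Fin 2) :
    (arrowMap a b w).app i ≫ arrowToEnd u' i = arrowToEnd u i ≫ b :=
  ((arrowMap a b w).naturality _).symm

/-- The cube with the value `V` at `(1, …, 1)` and `U` elsewhere. -/
noncomputable def topCube (m : ℕ) : Cube m ⥤ D :=
  (Cube.topIndex_monotone m).functor ⋙ ComposableArrows.mk₁ u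

variable {u} in
/-- The map of cubes given by a commutative square. -/
noncomputable def topCubeMap (m : ℕ) (φ : ComposableArrows.mk₁ u ⟶ ComposableArrows.mk₁ u') :
    topCube u m ⟶ topCube u' m :=
  Functor.whiskerLeft (Cube.topIndex_monotone m).functor φ

variable {u} in
/-- A map to the cube with the value `V` at `(1, …, 1)` and `U` elsewhere. -/
noncomputable def toTopCube {m : ℕ} {X : Cube m ⥤ D}
    (κ : ∀ a, a ≠ Cube.top m → (X.obj a ⟶ U)) (t : X ⟶ (Functor.const _).obj V)
    (hκ : ∀ a b (f : a ⟶ b) ha hb, X.map f ≫ κ b hb = κ a ha)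
    (h : ∀ a ha, κ a ha ≫ u = t.app a) : X ⟶ topCube u m where
  app a := arrowIn (Cube.topIndex m a) (fun h => κ a (Cube.ne_of_topIndex h)) (t.app a)
  naturality a b f := arrowIn_naturality u (X.map f) _ _
    ((Cube.topIndex_monotone m).functor.map f) _ _ _ _
    (fun _ _ => hκ a b f _ _) ((t.naturality f).trans (Category.comp_id _)) (fun _ => h a _)

end TopCube

/-! ### Cofibrancy of `L^m Y` and of its inclusion into `C^(m+1) Y` -/

variable {D : Type u} [Category.{v} D] [ModelCategory D] [SimplicialCategory D]
  [SimplicialModelCategory D] [HasZeroMorphisms D]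

/-- This is the lifting property of `ℂ^(m)` of the map from the initial object to `Y`, since `ℂ^(m)`
preserves initial objects. -/
lemma exists_lift_coneCube {Y : D} [IsCofibrant Y] (m : ℕ) {E E' : Cube m ⥤ D} (p : E ⟶ E')
    (hp : ∀ a, Fibration (p.app a)) (hp' : ∀ a, WeakEquivalence (p.app a))
    (t : (coneCube D m).obj Y ⟶ E') : ∃ l : (coneCube D m).obj Y ⟶ E, l ≫ p = t := by
  have := hasLiftingProperty_coneCube_map m (initial.to Y) p hp hp'
  have hI : IsInitial ((coneCube D m).obj (⊥_ D)) := initialIsInitial.isInitialObj _ _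
  have sq : CommSq (hI.to E) ((coneCube D m).map (initial.to Y)) p t := ⟨hI.hom_ext _ _⟩
  exact ⟨sq.lift, sq.fac_right⟩

lemma exists_lift_topCube {Y : D} [IsCofibrant Y] (m : ℕ) {U V U' V' : D} {u : U ⟶ V}
    {u' : U' ⟶ V'} (a : U ⟶ U') (b : V ⟶ V') [Fibration a] [WeakEquivalence a] [Fibration b]
    [WeakEquivalence b] (w : u ≫ b = a ≫ u') (t : (coneCube D m).obj Y ⟶ topCube u' m) :
    ∃ l : (coneCube D m).obj Y ⟶ topCube u m,
      l ≫ topCubeMap m (arrowMap a b w) = t := by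
  refine exists_lift_coneCube m _ (fun c => ?_) (fun c => ?_) t
  · change Fibration ((arrowMap a b w).app (Cube.topIndex m c))
    generalize Cube.topIndex m c = i
    fin_cases i
    · exact ‹Fibration a›
    · exact ‹Fibration b›
  · change WeakEquivalence ((arrowMap a b w).app (Cube.topIndex m c))
    generalize Cube.topIndex m c = i
    fin_cases i
    · exact ‹WeakEquivalence a›
    · exact ‹WeakEquivalence b›

/-- The inclusions of the values of the punctured cube in its colimit `L^m Y`. -/
noncomputable def Lι (m : ℕ) (Y : D) (a : Cube (m + 1)) (ha : a ≠ Cube.top (m + 1)) :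
    ((coneCube D (m + 1)).obj Y).obj a ⟶ L m Y :=
  colimit.ι (puncturedConeCube m Y) ⟨a, ha⟩

lemma Lι_w {m : ℕ} {Y : D} (a b : Cube (m + 1)) (f : a ⟶ b) (ha : a ≠ Cube.top (m + 1))
    (hb : b ≠ Cube.top (m + 1)) : ((coneCube D (m + 1)).obj Y).map f ≫ Lι m Y b hb = Lι m Y a ha :=
  colimit.w (puncturedConeCube m Y) (homOfLE f.le : (⟨a, ha⟩ : PuncturedCube m) ⟶ ⟨b, hb⟩)

lemma L_hom_ext {m : ℕ} {Y Z : D} {f g : L m Y ⟶ Z} (h : ∀ a ha, Lι m Y a ha ≫ f = Lι m Y a ha ≫ g) :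
    f = g :=
  colimit.hom_ext fun a => h a.1 a.2

lemma exists_Lι_comp_eq {m : ℕ} {Y Z : D}
    (κ : ∀ a, a ≠ Cube.top (m + 1) → (((coneCube D (m + 1)).obj Y).obj a ⟶ Z))
    (hκ : ∀ a b (f : a ⟶ b) ha hb, ((coneCube D (m + 1)).obj Y).map f ≫ κ b hb = κ a ha) :
    ∃ d : L m Y ⟶ Z, ∀ a ha, Lι m Y a ha ≫ d = κ a ha :=
  ⟨colimit.desc (puncturedConeCube m Y)
    { pt := Z
      ι :=
        { app := fun a => κ a.1 a.2
          naturality := fun a b f =>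
            (hκ a.1 b.1 (homOfLE f.le) a.2 b.2).trans (Category.comp_id _).symm } },
    fun a ha => colimit.ι_desc _ (⟨a, ha⟩ : PuncturedCube m)⟩

-- A map from `ℂ^(m+1) Y` to the cube with value `0` at the last vertex and `E` elsewhere is a map
-- from the punctured cube to `E`, that is, a map `L^m Y ⟶ E`. So lifting maps out of `L^m Y` is
-- lifting maps of cubes.
open scoped ZeroObject in
instance isCofibrant_L [HasZeroObject D] (m : ℕ) (Y : D) [IsCofibrant Y] : IsCofibrant (L m Y) := by
  refine cofibration_of_hasLiftingProperty _ fun {E E'} p _ _ => ⟨fun {s t} _ => ?_⟩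
  have w : (0 : E ⟶ (0 : D)) ≫ 𝟙 (0 : D) = p ≫ (0 : E' ⟶ (0 : D)) := by simp
  obtain ⟨l, hl⟩ := exists_lift_topCube (Y := Y) (m + 1) p (𝟙 (0 : D)) w
    (toTopCube (fun a ha => Lι m Y a ha ≫ t)
      { app := fun _ => 0, naturality := fun _ _ _ => (isZero_zero D).eq_of_tgt _ _ }
      (fun a b f ha hb => by rw [← Category.assoc, Lι_w])
      (fun a ha => (isZero_zero D).eq_of_tgt _ _))
  have hl' (a) (ha : a ≠ Cube.top (m + 1)) := congrArg
    (· ≫ arrowOut (0 : E' ⟶ (0 : D)) _ (Cube.topIndex_of_ne ha)) (NatTrans.congr_app hl a)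
  obtain ⟨d, hd⟩ := exists_Lι_comp_eq
    (fun a ha => l.app a ≫ arrowOut (0 : E ⟶ (0 : D)) _ (Cube.topIndex_of_ne ha))
    (fun a b f ha hb => by
      have h₂ := arrowOut_naturality (0 : E ⟶ (0 : D)) _ _
        ((Cube.topIndex_monotone (m + 1)).functor.map f)
        (Cube.topIndex_of_ne ha) (Cube.topIndex_of_ne hb)
      refine (Category.assoc _ _ _).symm.trans ?_
      refine (congrArg (· ≫ arrowOut _ _ (Cube.topIndex_of_ne hb)) (l.naturality f)).trans ?_
      refine (Category.assoc _ _ _).trans ?_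
      exact congrArg (l.app a ≫ ·) h₂)
  refine ⟨⟨d, initialIsInitial.hom_ext _ _, ?_⟩⟩
  refine L_hom_ext fun a ha => ?_
  refine (Category.assoc _ _ _).symm.trans ((congrArg (· ≫ p) (hd a ha)).trans ?_)
  refine (Category.assoc _ _ _).trans ?_
  refine (congrArg (l.app a ≫ ·) (arrowMap_out p (𝟙 (0 : D)) w _ _).symm).trans ?_
  refine (Category.assoc _ _ _).symm.trans ((hl' a ha).trans ?_)
  exact arrowIn_out _ _ _ _ _

lemma isIso_collapse_top : ∀ (m : ℕ) (Y : D), IsIso ((collapse m Y).app (Cube.top m))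
  | 0, Y => inferInstanceAs (IsIso (𝟙 Y))
  | m + 1, Y => isIso_collapse_top m ((cone D).obj Y)

/-- The component of `collapse` at `a`. -/
noncomputable def collapseApp (m : ℕ) (Y : D) (a : Cube m) :
    ((coneCube D m).obj Y).obj a ⟶ (coneIter D m).obj Y :=
  (collapse m Y).app a

instance (m : ℕ) (Y : D) : IsIso (collapseApp m Y (Cube.top m)) := isIso_collapse_top m Y

lemma map_collapseApp {m : ℕ} {Y : D} (a b : Cube m) (f : a ⟶ b) :
    ((coneCube D m).obj Y).map f ≫ collapseApp m Y b = collapseApp m Y a :=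
  ((collapse m Y).naturality f).trans (Category.comp_id _)

lemma exists_boundaryι (m : ℕ) (Y : D) : ∃ d : L m Y ⟶ (coneIter D (m + 1)).obj Y,
    ∀ a ha, Lι m Y a ha ≫ d = collapseApp (m + 1) Y a :=
  exists_Lι_comp_eq _ fun a b f _ _ => map_collapseApp a b f

/-- The inclusion `L^m Y ⟶ C^(m+1) Y`. -/
noncomputable def boundaryι (m : ℕ) (Y : D) : L m Y ⟶ (coneIter D (m + 1)).obj Y :=
  (exists_boundaryι m Y).choose

lemma Lι_boundaryι (m : ℕ) (Y : D) (a : Cube (m + 1)) (ha : a ≠ Cube.top (m + 1)) :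
    Lι m Y a ha ≫ boundaryι m Y = collapseApp (m + 1) Y a :=
  (exists_boundaryι m Y).choose_spec a ha

/-- A square from the inclusion to `p : E ⟶ E'` is a map from `ℂ^(m+1) Y` to the top cube of `p`.
Lifting it to the top cube of `𝟙 E`, which is constant up to isomorphism, gives a map out of the
value `C^(m+1) Y` at the last vertex, and this is the diagonal. -/
instance cofibration_boundaryι (m : ℕ) (Y : D) [IsCofibrant Y] : Cofibration (boundaryι m Y) := by
  refine cofibration_of_hasLiftingProperty _ fun {E E'} p _ _ => ⟨fun {s t} sq => ?_⟩
  have w : 𝟙 E ≫ p = 𝟙 E ≫ p := rfl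
  have hκ : ∀ a ha, (Lι m Y a ha ≫ s) ≫ p =
      (collapse (m + 1) Y ≫ (Functor.const _).map t).app a := fun a ha => by
    rw [Category.assoc, sq.w, ← Category.assoc, Lι_boundaryι]
    rfl
  obtain ⟨l, hl⟩ := exists_lift_topCube (Y := Y) (m + 1) (𝟙 E) p w
    (toTopCube (fun a ha => Lι m Y a ha ≫ s) (collapse (m + 1) Y ≫ (Functor.const _).map t)
      (fun a b f ha hb => by rw [← Category.assoc, Lι_w]) hκ)
  let e (a : Cube (m + 1)) : ((coneCube D (m + 1)).obj Y).obj a ⟶ E :=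
    l.app a ≫ arrowToEnd (𝟙 E) _
  have he (a b : Cube (m + 1)) (f : a ⟶ b) : ((coneCube D (m + 1)).obj Y).map f ≫ e b = e a := by
    have h₂ := arrowToEnd_naturality (𝟙 E) _ _ ((Cube.topIndex_monotone (m + 1)).functor.map f)
    refine (Category.assoc _ _ _).symm.trans ?_
    refine (congrArg (· ≫ arrowToEnd _ _) (l.naturality f)).trans ?_
    refine (Category.assoc _ _ _).trans ?_
    exact congrArg (l.app a ≫ ·) h₂
  have he₁ (a) (ha : a ≠ Cube.top (m + 1)) : e a = Lι m Y a ha ≫ s := by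
    have h₁ := congrArg (· ≫ arrowOut p _ (Cube.topIndex_of_ne ha)) (NatTrans.congr_app hl a)
    have h₂ : arrowToEnd (𝟙 E) (Cube.topIndex (m + 1) a) =
      arrowOut (𝟙 E) _ (Cube.topIndex_of_ne ha) ≫ 𝟙 E := (arrowOut_comp _ _ _).symm
    refine (congrArg (l.app a ≫ ·) (h₂.trans
      (arrowMap_out (𝟙 E) p w _ (Cube.topIndex_of_ne ha)).symm)).trans ?_
    refine (Category.assoc _ _ _).symm.trans (h₁.trans ?_)
    exact arrowIn_out _ _ _ _ _
  have he₂ : e (Cube.top (m + 1)) ≫ p = collapseApp (m + 1) Y (Cube.top (m + 1)) ≫ t := by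
    refine (Category.assoc _ _ _).trans ?_
    refine (congrArg (l.app _ ≫ ·) (arrowMap_toEnd (𝟙 E) p w _).symm).trans ?_
    refine (Category.assoc _ _ _).symm.trans ?_
    refine (congrArg (· ≫ arrowToEnd _ _) (NatTrans.congr_app hl _)).trans ?_
    exact arrowIn_toEnd _ _ _ _ fun _ => hκ _ _
  obtain ⟨d, hd⟩ : ∃ d, collapseApp (m + 1) Y (Cube.top (m + 1)) ≫ d = e (Cube.top (m + 1)) :=
    ⟨inv (collapseApp (m + 1) Y (Cube.top (m + 1))) ≫ e _, IsIso.hom_inv_id_assoc _ _⟩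
  refine ⟨⟨d, ?_, ?_⟩⟩
  · refine L_hom_ext fun a ha => ?_
    rw [← he₁, ← Category.assoc, Lι_boundaryι, ← map_collapseApp _ _ (homOfLE (Cube.le_top a)),
      Category.assoc, hd, he]
  · rw [← cancel_epi (collapseApp (m + 1) Y (Cube.top (m + 1))), reassoc_of% hd, he₂]

end Toda

namespace Toda

/-! ### Extending nullhomotopic maps -/

section

variable {D : Type u} [Category.{v} D] [ModelCategory D] [HasZeroMorphisms D]

/-- For `A` cofibrant and `Z` fibrant, equality in `Ho D` is given by a right homotopy from `0` to
`f`. The zero map extends over `B`; homotopy extension moves this extension to one of `f`. -/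
lemma exists_extension_of_isNullhomotopic {A B Z : D} [IsCofibrant A] [IsFibrant Z] (i : A ⟶ B)
    [Cofibration i] (f : A ⟶ Z) (hf : IsNullhomotopic f) : ∃ g : B ⟶ Z, i ≫ g = f := by
  have h := (RightHomotopyRel.iff_map_eq (weakEquivalences D).Q A Z).2 hf.symm
  obtain ⟨P, _, ⟨h⟩⟩ := h.exists_good_pathObject
  obtain ⟨g, h', w⟩ := h.homotopy_extension i 0 comp_zero
  exact ⟨g, by rw [← h'.h₁, ← Category.assoc, w, h.h₁]⟩

lemma IsNullhomotopic.comp {A B C E : D} {f : B ⟶ C} (h : IsNullhomotopic f) (g : A ⟶ B)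
    (k : C ⟶ E) : IsNullhomotopic (g ≫ f ≫ k) := by
  have h' : (weakEquivalences D).Q.map (g ≫ f ≫ k) =
      (weakEquivalences D).Q.map (g ≫ (0 : B ⟶ C) ≫ k) := by
    rw [Functor.map_comp, Functor.map_comp, h, ← Functor.map_comp, ← Functor.map_comp]
  rwa [zero_comp, comp_zero] at h'

end

variable {D : Type u} [Category.{v} D] [ModelCategory D] [SimplicialCategory D]
  [SimplicialModelCategory D] [HasZeroMorphisms D]

namespace CubicalTodaSystem

/-- The face map with parameters `p`, `q` is the edge of the cone cube from `r_(q+1)` to the last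
vertex, so the relation is the hypothesis at `r_(q+1)`. Dropping a leading `1` replaces `Y` by `C Y`
and shifts the family, which reduces to `q = 0`. -/
lemma coface_comp_of_leg {n N : ℕ} {X : ComposableArrows D N} (S : CubicalTodaSystem n N X) (p : ℕ) :
    ∀ (q s : ℕ) {Y Z : D} (hm : p + q ≤ n) (G : S.Family s Y (p + q) (by lia)) (u t : Fin (N + 1))
      (ht : s + (p + q) + 1 = t) (hu : s + q = u) (r : X.obj t ⟶ Z)
      (H : (coneIter D (p + q + 1)).obj Y ⟶ Z)
      (_ : ∀ a ha, collapseApp (p + q + 1) Y a ≫ H = S.leg (p + q) s hm G t ht a ha ≫ r),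
      coface p q Y ≫ H =
        (coneIter D p).map (G.G q (by lia) u hu) ≫ S.F p (by lia) u t (by lia) ≫ r
  | 0, s, Y, Z, hm, G, u, t, ht, hu, r, H, w => by
    obtain rfl : u = ⟨s, by lia⟩ := Fin.ext hu.symm
    -- The vertex `r_1 = (0, 1, …, 1)`.
    have h₁ := w (Cube.cons false (Cube.top p)) (fun h => Bool.false_ne_true (congrArg Prod.fst h))
    have h₂ := collapse_naturality p ((coneι D).app Y) (Cube.top p)
    have := isIso_collapse_top p Y
    refine (cancel_epi ((collapse p Y).app (Cube.top p))).1 ?_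
    refine (Category.assoc _ _ _).symm.trans ((congrArg (· ≫ H) h₂).symm.trans (h₁.trans ?_))
    refine (congrArg (· ≫ r) (S.leg_false p s hm G t ht (Cube.top p) _)).trans ?_
    refine (Category.assoc _ _ _).trans (congrArg (_ ≫ ·) ?_)
    exact Category.assoc _ _ _
  | q + 1, s, Y, Z, hm, G, u, t, ht, hu, r, H, w =>
    coface_comp_of_leg S p q (s + 1) (Y := (cone D).obj Y) (by lia)
      (Family.shift (m := p + q) (hm := by lia) G) u t (by lia) (by lia) r H
      fun a ha => w (Cube.cons true a) (fun h => ha (congrArg Prod.snd h))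

/-- This produces the missing map of order `n + 1`, after passing to a cofibrant source and a
fibrant target. The indices `j` and `t` are variables so that truncated indices can be substituted
later. -/
lemma exists_coface_comp_eq [HasZeroObject D] {n : ℕ} {X : ComposableArrows D (n + 2)}
    (S : CubicalTodaSystem n (n + 2) X) (hT : IsNullhomotopic S.todaBracket) {Y Z : D}
    [IsCofibrant Y] [IsFibrant Z] (j : Fin (n + 3)) (hj : j = ⟨0, by lia⟩) (g : Y ⟶ X.obj j)
    (t : Fin (n + 3)) (ht : t = ⟨n + 2, by lia⟩)
    (r : X.obj t ⟶ Z) :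
    ∃ H : (coneIter D (n + 1)).obj Y ⟶ Z,
      ∀ (p q : ℕ) (h : p + q + 1 = n + 1) (u : Fin (n + 3)) (hu : (j : ℕ) + q + 1 = u)
        (hu' : (u : ℕ) + p + 1 = t),
        coface p q Y ≫ eqToHom (by rw [h]) ≫ H =
          (coneIter D p).map ((coneIter D q).map g ≫ S.F q (by lia) j u hu) ≫
            S.F p (by lia) u t hu' ≫ r := by
  subst hj ht
  let R := S.row 0 (by lia) n le_rfl
  have ht : 1 + n + 1 = ((⟨n + 2, by lia⟩ : Fin (n + 2 + 1)) : ℕ) := by simp; lia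
  -- The map `d` is `L^n g`. The composite of `d`, the bracket and `r` is still nullhomotopic, and
  -- is what gets extended over `C^(n+1) Y`.
  obtain ⟨d, hd⟩ := exists_Lι_comp_eq (m := n) (Y := Y)
    (fun a ha => ((coneCube D (n + 1)).map g).app a ≫ Lι n _ a ha) (fun a b f ha hb => by
      rw [NatTrans.naturality_assoc, Lι_w])
  obtain ⟨H, hH⟩ := exists_extension_of_isNullhomotopic (boundaryι n Y) _ (hT.comp d r)
  have hleg (a : Cube (n + 1)) (ha) : collapseApp (n + 1) Y a ≫ H =
      S.leg n 1 le_rfl (R.pull g) ⟨n + 2, by lia⟩ ht a ha ≫ r := by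
    have h₁ : Lι n (X.obj ⟨0, by lia⟩) a ha ≫ S.todaBracket =
        S.leg n 1 le_rfl R ⟨n + 2, by lia⟩ ht a ha :=
      colimit.ι_desc _ (⟨a, ha⟩ : PuncturedCube n)
    rw [← Lι_boundaryι n Y a ha, Category.assoc, hH, ← Category.assoc, hd, leg_pull, Category.assoc,
      ← Category.assoc _ _ r, h₁, Category.assoc]
  refine ⟨H, fun p q h u hu hu' => ?_⟩
  obtain rfl : p + q = n := by lia
  rw [eqToHom_refl, Category.id_comp]
  exact S.coface_comp_of_leg p q 1 le_rfl (R.pull g) u ⟨p + q + 2, by lia⟩ ht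
    (by simp at hu; lia) r H hleg

end CubicalTodaSystem

end Toda

namespace Toda

/-! ### Systems of maps of unbounded order -/

variable {D : Type u} [Category.{v} D] [ModelCategory D] [SimplicialCategory D]
  [SimplicialModelCategory D] [HasZeroMorphisms D]

/-- Maps `F^(k)_j : C^k U_j ⟶ U_(j+k+1)` for all `k` and `j`, such that
`d_r (F^(k)_j) = F^(k-r)_(j+r) ∘ C^(k-r) (F^(r-1)_j)` for `1 ≤ r ≤ k`. -/
structure ConeSystem (U : ℕ → D) where
  F (k j t : ℕ) (ht : j + k + 1 = t) : (coneIter D k).obj (U j) ⟶ U t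
  faces (p q j u t : ℕ) (hu : j + q + 1 = u) (ht : u + p + 1 = t) :
    coface p q (U j) ≫ F (p + q + 1) j t (by lia) = (coneIter D p).map (F q j u hu) ≫ F p u t ht

namespace ConeSystem

variable {U : ℕ → D} (S : ConeSystem U)

/-- A family of maps `G^(k) : C^k Y ⟶ U_(s+k)` with
`d_r (G^(k)) = F^(k-r)_(s+r-1) ∘ C^(k-r) (G^(r-1))`. -/
structure Family (s : ℕ) (Y : D) where
  G (k t : ℕ) (ht : s + k = t) : (coneIter D k).obj Y ⟶ U t
  faces (p q u t : ℕ) (hu : s + q = u) (ht : u + p + 1 = t) :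
    coface p q Y ≫ G (p + q + 1) t (by lia) = (coneIter D p).map (G q u hu) ≫ S.F p u t ht

variable {S}

namespace Family

/-- The map `G^(0) : Y ⟶ U_s`. -/
def base {s : ℕ} {Y : D} (G : S.Family s Y) : Y ⟶ U s := G.G 0 s rfl

/-- Precomposition of a family with a map. -/
noncomputable def pull {s : ℕ} {Y Z : D} (g : Z ⟶ Y) (G : S.Family s Y) : S.Family s Z where
  G k t ht := (coneIter D k).map g ≫ G.G k t ht
  faces p q u t hu ht := by
    rw [← Category.assoc, ← coface_naturality, Category.assoc, G.faces p q u t hu ht,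
      Functor.map_comp, Category.assoc]

/-- The maps `G^(k+1) : C^k (C Y) ⟶ U_(s+1+k)` of a family. -/
noncomputable def shift {s : ℕ} {Y : D} (G : S.Family s Y) :
    S.Family (s + 1) ((cone D).obj Y) where
  G k t ht := G.G (k + 1) t (by lia)
  faces p q u t hu ht := G.faces p (q + 1) u t (by lia) ht

variable (S) in
/-- The family `F^(k)_s`. -/
noncomputable def row (s : ℕ) : S.Family (s + 1) (U s) where
  G k t ht := S.F k s t (by lia)
  faces p q u t hu ht := S.faces p q s u t (by lia) ht

/-- The relation for `d_1` is the compatibility needed to glue a family along `Y ⟶ C Y`. -/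
lemma coneι_shift {s : ℕ} {Y : D} (G : S.Family s Y) (k t : ℕ) (ht : s + 1 + k = t) :
    (coneIter D k).map ((coneι D).app Y) ≫ G.shift.G k t ht =
      (coneIter D k).map G.base ≫ (row S s).G k t ht :=
  G.faces k 0 s t rfl (by lia)

lemma isPushout_coneIter_map (k : ℕ) {A B C P : D} {i : A ⟶ B} {j : A ⟶ C} {inl : B ⟶ P}
    {inr : C ⟶ P} (sq : IsPushout i j inl inr) :
    IsPushout ((coneIter D k).map i) ((coneIter D k).map j) ((coneIter D k).map inl)
      ((coneIter D k).map inr) :=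
  sq.map _

lemma exists_glue {s : ℕ} {A B C P : D} {i : A ⟶ B} {j : A ⟶ C} {inl : B ⟶ P}
    {inr : C ⟶ P} (sq : IsPushout i j inl inr) (G : S.Family s B) (G' : S.Family s C)
    (h : ∀ k t ht, (coneIter D k).map i ≫ G.G k t ht = (coneIter D k).map j ≫ G'.G k t ht) :
    ∃ K : S.Family s P, ∀ k t ht, (coneIter D k).map inl ≫ K.G k t ht = G.G k t ht ∧
      (coneIter D k).map inr ≫ K.G k t ht = G'.G k t ht := by
  have hK (k t : ℕ) (ht : s + k = t) : ∃ d : (coneIter D k).obj P ⟶ U t,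
      (coneIter D k).map inl ≫ d = G.G k t ht ∧ (coneIter D k).map inr ≫ d = G'.G k t ht :=
    ⟨(isPushout_coneIter_map k sq).desc _ _ (h k t ht), IsPushout.inl_desc _ _ _ _,
      IsPushout.inr_desc _ _ _ _⟩
  choose K hl hr using hK
  refine ⟨⟨K, fun p q u t hu ht => ?_⟩, fun k t ht => ⟨hl k t ht, hr k t ht⟩⟩
  refine (isPushout_coneIter_map p (isPushout_coneIter_map q sq)).hom_ext ?_ ?_
  · rw [← Category.assoc, coface_naturality, Category.assoc, hl, G.faces p q u t hu ht,
      ← Category.assoc, ← Functor.map_comp, hl]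
  · rw [← Category.assoc, coface_naturality, Category.assoc, hr, G'.faces p q u t hu ht,
      ← Category.assoc, ← Functor.map_comp, hr]

end Family

variable (S) in
/-- The family of zero maps. -/
noncomputable def Family.zero (s : ℕ) {Z : D} (h : IsZero Z) : S.Family s Z where
  G _ _ _ := 0
  faces p q _ _ _ _ :=
    ((h.isInitial.isInitialObj (coneIter D q) _).isInitialObj (coneIter D p) _).hom_ext _ _

/-! ### The tower of a system -/

lemma isInitial_cone_initial : Nonempty (IsInitial ((cone D).obj (⊥_ D))) :=
  ⟨initialIsInitial.isInitialObj _ _⟩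

instance isCofibrant_cone (W : D) [IsCofibrant W] : IsCofibrant ((cone D).obj W) := by
  obtain ⟨h⟩ := isInitial_cone_initial (D := D)
  have : Cofibration (initial.to W) := ‹IsCofibrant W›
  exact (isCofibrant_iff_of_isInitial ((cone D).map (initial.to W)) h).2 inferInstance

open scoped ZeroObject

variable [HasZeroObject D]

/-- The cone of the map from the initial object to `W` is a trivial cofibration whose source is a
zero object. -/
lemma weakEquivalence_cone_to_zero (W : D) [IsCofibrant W] :
    WeakEquivalence (0 : (cone D).obj W ⟶ 0) := by
  obtain ⟨h⟩ := isInitial_cone_initial (D := D)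
  have : Cofibration (initial.to W) := ‹IsCofibrant W›
  have : IsIso (0 : (cone D).obj (⊥_ D) ⟶ 0) :=
    ⟨0, h.hom_ext _ _, (isZero_zero D).eq_of_src _ _⟩
  exact weakEquivalence_of_precomp_of_fac
    (comp_zero : (cone D).map (initial.to W) ≫ (0 : (cone D).obj W ⟶ 0) = 0)

variable (S) in
/-- The data from which one step of the tower of a system is built: a cofibration from a
contractible object, and a family. -/
structure TowerStage (k : ℕ) where
  V : D
  W : D
  v : V ⟶ W
  cofibration_v : Cofibration v
  isCofibrant_W : IsCofibrant W
  weakEquivalence_V : WeakEquivalence (0 : V ⟶ 0)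
  fam : S.Family k W

namespace TowerStage

attribute [instance] cofibration_v isCofibrant_W weakEquivalence_V

variable {k : ℕ} (T : S.TowerStage k)

/-- The factorization of the map `W ⟶ U_k` through a trivial fibration. -/
noncomputable def factor : MorphismProperty.MapFactorizationData (cofibrations D)
    (trivialFibrations D) T.fam.base :=
  MorphismProperty.factorizationData _ _ _

/-- The object `W_(k+1)`. -/
noncomputable def succW : D := pushout T.factor.i ((coneι D).app T.W)

/-- The cofibration `C W_k ⟶ W_(k+1)`. -/
noncomputable def coneToSuccW : (cone D).obj T.W ⟶ T.succW :=
  pushout.inr T.factor.i ((coneι D).app T.W)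

instance : Cofibration T.coneToSuccW :=
  (cofibration_iff _).2 (MorphismProperty.of_isPushout (IsPushout.of_hasPushout _ _).flip
    (mem_cofibrations T.factor.i))

/-- On `X̃_k` the family is the row of the system at `k`, pulled back from `U_k`; on `C W_k` it is
the shift of the given family. Both restrict to the same maps on `W_k` because `W_k ⟶ X̃_k ⟶ U_k` is
the base map. -/
lemma exists_succFam : ∃ K : S.Family (k + 1) T.succW, ∀ m t ht,
    (coneIter D m).map (pushout.inl T.factor.i ((coneι D).app T.W)) ≫ K.G m t ht =
      ((Family.row S k).pull T.factor.p).G m t ht ∧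
    (coneIter D m).map T.coneToSuccW ≫ K.G m t ht =
      T.fam.shift.G m t ht :=
  Family.exists_glue (IsPushout.of_hasPushout _ _) _ _ fun m t ht => by
    rw [Family.coneι_shift]
    refine (Category.assoc _ _ _).symm.trans (congrArg (· ≫ (Family.row S k).G m t ht) ?_)
    rw [← Functor.map_comp, T.factor.fac]

/-- The next stage of the tower. -/
noncomputable def succ : S.TowerStage (k + 1) where
  V := (cone D).obj T.W
  W := T.succW
  v := T.coneToSuccW
  cofibration_v := inferInstance
  isCofibrant_W := isCofibrant_of_cofibration T.coneToSuccW
  weakEquivalence_V := weakEquivalence_cone_to_zero T.W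
  fam := T.exists_succFam.choose

/-- The object `X̃_k`. -/
noncomputable def obj : D := T.factor.Z

/-- The trivial fibration `X̃_k ⟶ U_k`. -/
noncomputable def toU : T.obj ⟶ U k := T.factor.p

/-- The cofibration `W_k ⟶ X̃_k`. -/
noncomputable def ofW : T.W ⟶ T.obj := T.factor.i

instance : WeakEquivalence T.toU := inferInstanceAs (WeakEquivalence T.factor.p)

instance : Cofibration T.ofW := inferInstanceAs (Cofibration T.factor.i)

/-- The map `X̃_k ⟶ W_(k+1)`. -/
noncomputable def toSuccW : T.obj ⟶ T.succ.W := pushout.inl T.factor.i ((coneι D).app T.W)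

/-- The map `W_k ⟶ C W_k`. -/
noncomputable def toSuccV : T.W ⟶ T.succ.V := (coneι D).app T.W

lemma ofW_toSuccW : T.ofW ≫ T.toSuccW = T.toSuccV ≫ T.succ.v := pushout.condition

/-- The map `X̃_k ⟶ X̃_(k+1)`. -/
noncomputable def map : T.obj ⟶ T.succ.obj := T.toSuccW ≫ T.succ.ofW

lemma map_toU : T.map ≫ T.succ.toU = T.toU ≫ S.F 0 k (k + 1) rfl := by
  have h₁ : T.succ.ofW ≫ T.succ.toU = T.succ.fam.base := T.succ.factor.fac
  have h₂ : T.toSuccW ≫ T.succ.fam.base = T.toU ≫ S.F 0 k (k + 1) rfl :=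
    (T.exists_succFam.choose_spec 0 (k + 1) rfl).1
  rw [map, Category.assoc, h₁, h₂]

/-- The strict cofiber of `V_k ⟶ X̃_k`. -/
noncomputable def strict : D := pushout (0 : T.V ⟶ 0) (T.v ≫ T.ofW)

/-- The projection `X̃_k ⟶ X̃_k / V_k`. -/
noncomputable def toStrict : T.obj ⟶ T.strict := pushout.inr _ _

lemma v_toStrict : T.v ≫ T.ofW ≫ T.toStrict = 0 := by
  have h : (0 : T.V ⟶ 0) ≫ pushout.inl _ _ = (T.v ≫ T.ofW) ≫ T.toStrict := pushout.condition
  rw [← Category.assoc, ← h, zero_comp]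
  rfl

instance [ProperModelCategory D] : WeakEquivalence T.toStrict :=
  ProperModelCategory.weakEquivalence_of_isPushout
    (IsPushout.of_hasPushout (0 : T.V ⟶ 0) (T.v ≫ T.ofW))

/-- On `W_k` the map to `X̃_(k+1)` passes through `C W_k = V_(k+1)`, which the quotient collapses.
-/
lemma ofW_map_toStrict : T.ofW ≫ T.map ≫ T.succ.toStrict = 0 := by
  rw [map, Category.assoc, reassoc_of% T.ofW_toSuccW, v_toStrict, comp_zero]

lemma strict_hom_ext {Z : D} {f g : T.strict ⟶ Z} (h : T.toStrict ≫ f = T.toStrict ≫ g) : f = g :=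
  pushout.hom_ext ((isZero_zero D).eq_of_src _ _) h

lemma exists_strictMap : ∃ d : T.strict ⟶ T.succ.strict, T.toStrict ≫ d = T.map ≫ T.succ.toStrict :=
  ⟨pushout.desc 0 (T.map ≫ T.succ.toStrict) (by
      rw [zero_comp, Category.assoc, ofW_map_toStrict, comp_zero]), pushout.inr_desc _ _ _⟩

/-- The map `X̃_k / V_k ⟶ X̃_(k+1) / V_(k+1)`. -/
noncomputable def strictMap : T.strict ⟶ T.succ.strict := T.exists_strictMap.choose

lemma toStrict_strictMap : T.toStrict ≫ T.strictMap = T.map ≫ T.succ.toStrict :=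
  T.exists_strictMap.choose_spec

/-- The first map factors through `W_(k+1)`, where the second one vanishes modulo `V_(k+2)`. -/
lemma strictMap_strictMap : T.strictMap ≫ T.succ.strictMap = 0 := by
  apply T.strict_hom_ext
  rw [← Category.assoc, toStrict_strictMap, Category.assoc, toStrict_strictMap, map,
    Category.assoc, ofW_map_toStrict, comp_zero, comp_zero]

end TowerStage

variable (S) in
/-- The tower of a system. -/
noncomputable def tower : ∀ k, S.TowerStage k
  | 0 =>
    -- With `V = W = 0`, the object `X̃_0` is a cofibrant replacement of `U_0`.
    { V := 0
      W := 0
      v := 𝟙 0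
      cofibration_v := inferInstance
      isCofibrant_W := (isCofibrant_iff_of_isInitial (𝟙 (0 : D)) (isZero_zero D).isInitial).2
        inferInstance
      weakEquivalence_V := by
        rw [show (0 : (0 : D) ⟶ 0) = 𝟙 0 from (isZero_zero D).eq_of_src _ _]
        infer_instance
      fam := Family.zero S 0 (isZero_zero D) }
  | k + 1 => (tower k).succ

end ConeSystem

end Toda

namespace Toda

/-! ### The system of a cubical Toda system with nullhomotopic bracket -/

/-- The index `i`, truncated at `N`. -/
def clamp (N i : ℕ) : Fin (N + 1) := ⟨min i N, by lia⟩

lemma clamp_val {N i : ℕ} (h : i ≤ N) : (clamp N i : ℕ) = i := min_eq_left h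

lemma clamp_le (N i : ℕ) : clamp N i ≤ clamp N (i + 1) := Fin.le_def.2 (min_le_min_right N i.le_succ)

section

variable {D : Type u} [Category.{v} D] [ModelCategory D] [SimplicialCategory D]
  [SimplicialModelCategory D] [HasZeroMorphisms D]

/-- Maps of order at most `n` are transported along `s` and `r`. The only map of order `n + 1`
ending by the index `n + 2` runs from `0` to `n + 2` and comes from the bracket; maps ending later
are zero. -/
lemma CubicalTodaSystem.exists_coneSystem {n : ℕ} {X : ComposableArrows D (n + 2)}
    [HasZeroObject D] (S : CubicalTodaSystem n (n + 2) X) (hT : IsNullhomotopic S.todaBracket)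
    {U : ℕ → D} [IsCofibrant (U 0)] [IsFibrant (U (n + 2))] (s : ∀ i, U i ⟶ X.obj (clamp (n + 2) i))
    (r : ∀ i, X.obj (clamp (n + 2) i) ⟶ U i)
    (hrs : ∀ i, i ≠ 0 → i ≠ n + 2 → r i ≫ s i = 𝟙 _) :
    ∃ K : ConeSystem U, ∀ i, i < n + 2 →
      K.F 0 i (i + 1) rfl = s i ≫ X.map (homOfLE (clamp_le _ i)) ≫ r (i + 1) := by
  obtain ⟨H, hH⟩ := S.exists_coface_comp_eq hT (clamp (n + 2) 0) (Fin.ext (by simp [clamp])) (s 0)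
    (clamp (n + 2) (n + 2)) (Fin.ext (by simp [clamp])) (r (n + 2))
  let H' (k j t : ℕ) (hk : k = n + 1) (hj : j = 0) (ht : t = n + 2) :
    (coneIter D k).obj (U j) ⟶ U t := by subst hk hj ht; exact H
  let F (k j t : ℕ) (ht : j + k + 1 = t) : (coneIter D k).obj (U j) ⟶ U t :=
    if h : t ≤ n + 2 then
      if hk : k ≤ n then (coneIter D k).map (s j) ≫
        S.F k hk (clamp _ j) (clamp _ t) (by rw [clamp_val h, clamp_val (by lia), ht]) ≫ r t
      else H' k j t (by lia) (by lia) (by lia)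
    else 0
  have hF (k j t : ℕ) (ht : j + k + 1 = t) (h : t ≤ n + 2) (hk : k ≤ n) : F k j t ht =
      (coneIter D k).map (s j) ≫ S.F k hk (clamp _ j) (clamp _ t)
        (by rw [clamp_val h, clamp_val (by lia), ht]) ≫ r t :=
    (dif_pos h).trans (dif_pos hk)
  have hF₀ (k j t : ℕ) (ht : j + k + 1 = t) (h : ¬ t ≤ n + 2) : F k j t ht = 0 := dif_neg h
  refine ⟨⟨F, fun p q j u t hu ht => ?_⟩, fun i hi => ?_⟩
  · by_cases h : t ≤ n + 2
    · have hru : r u ≫ s u = 𝟙 _ := hrs u (by lia) (by lia)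
      have hu' : (clamp (n + 2) j : ℕ) + q + 1 = clamp (n + 2) u := by
        rw [clamp_val (by lia), clamp_val (by lia), hu]
      have ht' : (clamp (n + 2) u : ℕ) + p + 1 = clamp (n + 2) t := by
        rw [clamp_val (by lia), clamp_val (by lia), ht]
      have h₂ : (coneIter D p).map (F q j u hu) ≫ F p u t ht =
          (coneIter D p).map ((coneIter D q).map (s j) ≫ S.F q (by lia) _ _ hu') ≫
            S.F p (by lia) _ _ ht' ≫ r t := by
        rw [hF q j u hu (by lia) (by lia), hF p u t ht h (by lia), ← Category.assoc,
          ← Functor.map_comp, Category.assoc, Category.assoc, hru, Category.comp_id]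
      rw [h₂]
      by_cases hk : p + q + 1 ≤ n
      · rw [hF _ j t (by lia) h hk, ← Category.assoc, ← coface_naturality, Category.assoc,
          ← Category.assoc (coface _ _ _), S.faces p q hk _ _ _ hu' ht', Functor.map_comp,
          Category.assoc, Category.assoc]
      · obtain rfl : n = p + q := by lia
        obtain rfl : j = 0 := by lia
        obtain rfl : t = p + q + 2 := by lia
        have h₁ : F (p + q + 1) 0 (p + q + 2) (by lia) = H :=
          (dif_pos le_rfl).trans (dif_neg (by lia))
        rw [h₁, ← hH p q rfl _ hu' ht', eqToHom_refl, Category.id_comp]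
    · rw [hF₀ _ j t (by lia) h, hF₀ p u t ht h, comp_zero, comp_zero]
  · refine (hF 0 i (i + 1) rfl hi n.zero_le).trans ?_
    rw [S.F_zero]
    rfl

end

/-! ### Linear diagrams indexed by natural numbers -/

section

variable {D : Type u} [Category.{v} D]

/-- The linear diagram of length `N` given by the beginning of a sequence of maps. -/
noncomputable def ofSequence (N : ℕ) {Z : ℕ → D} (z : ∀ i, Z i ⟶ Z (i + 1)) : ComposableArrows D N :=
  (Fin.val_strictMono (n := N + 1)).monotone.functor ⋙ Functor.ofSequence z

lemma ofSequence_map' (N : ℕ) {Z : ℕ → D} (z : ∀ i, Z i ⟶ Z (i + 1)) (i : ℕ) (hi : i + 1 ≤ N) :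
    (ofSequence N z).map' i (i + 1) = z i :=
  Functor.ofSequence_map_homOfLE_succ z i

variable [ModelCategory D]

lemma weaklyEquivalent_of_app {N : ℕ} {A B : ComposableArrows D N} (φ : ∀ i, A.obj i ⟶ B.obj i)
    (w : ∀ (i : ℕ) (hi : i < N), A.map' i (i + 1) ≫ φ ⟨i + 1, by lia⟩ =
      φ ⟨i, by lia⟩ ≫ B.map' i (i + 1)) (h : ∀ i, WeakEquivalence (φ i)) : WeaklyEquivalent A B :=
  .rel _ _ ⟨ComposableArrows.homMk φ w, h⟩

lemma weaklyEquivalent_ofSequence (N : ℕ) {Z Z' : ℕ → D} (z : ∀ i, Z i ⟶ Z (i + 1))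
    (z' : ∀ i, Z' i ⟶ Z' (i + 1)) (φ : ∀ i, Z i ⟶ Z' i)
    (w : ∀ i, i < N → z i ≫ φ (i + 1) = φ i ≫ z' i) (h : ∀ i, WeakEquivalence (φ i)) :
    WeaklyEquivalent (ofSequence N z) (ofSequence N z') :=
  weaklyEquivalent_of_app (fun i => φ i)
    (fun i hi => by rw [ofSequence_map', ofSequence_map']; exact w i hi) fun i => h i

lemma weaklyEquivalent_clamp {N : ℕ} (X : ComposableArrows D N) :
    WeaklyEquivalent X (ofSequence N fun i => X.map (homOfLE (clamp_le N i))) := by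
  have hc (i : Fin (N + 1)) : i = clamp N i := Fin.ext (clamp_val (by lia)).symm
  refine weaklyEquivalent_of_app (fun i => X.map (homOfLE (hc i).le)) (fun i hi => ?_) fun i => ?_
  · rw [ofSequence_map']
    exact ((X.map_comp _ _).symm.trans (congrArg X.map (Subsingleton.elim _ _))).trans (X.map_comp _ _)
  · have : IsIso (homOfLE (hc i).le) := ⟨homOfLE (hc i).ge, rfl, rfl⟩
    change WeakEquivalence (X.map (homOfLE (hc i).le))
    infer_instance

lemma isRectifiable_of_ofSequence [HasZeroMorphisms D] {N : ℕ} {X : ComposableArrows D N} {Z : ℕ → D}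
    (z : ∀ i, Z i ⟶ Z (i + 1)) (h : WeaklyEquivalent X (ofSequence N z))
    (hz : ∀ i, z i ≫ z (i + 1) = 0) : IsRectifiable X :=
  ⟨_, h, fun i hi => by
    rw [ofSequence_map', ofSequence_map']
    exact hz i⟩

/-- `P` marks the first object and `Q` the last. The zigzag `X ⟵ V ⟶ U` ends in a cofibrant
replacement under `P`, a fibrant one under `Q`, and `X` itself otherwise. The zero maps chosen for
`e` under `P` and for `s` under `Q` are placeholders, exempt from the relations. -/
lemma exists_replacement [HasZeroMorphisms D] (X : D) (P Q : Prop) (hPQ : P → ¬ Q) :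
    ∃ (V U : D) (a : V ⟶ X) (b : V ⟶ U) (s : U ⟶ X) (e : X ⟶ V), WeakEquivalence a ∧
      WeakEquivalence b ∧ (¬ Q → b ≫ s = a) ∧ (¬ P → e ≫ a = 𝟙 X) ∧ (P → IsCofibrant U) ∧
      (Q → IsFibrant U) := by
  by_cases hP : P
  · let h := MorphismProperty.factorizationData (cofibrations D) (trivialFibrations D)
      (initial.to X)
    exact ⟨h.Z, h.Z, h.p, 𝟙 _, h.p, 0, inferInstance, inferInstance,
      fun _ => Category.id_comp _, fun h => absurd hP h, 
      fun _ => (isCofibrant_iff_of_isInitial h.i initialIsInitial).2 inferInstance,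
      fun hQ => absurd hQ (hPQ hP)⟩
  · by_cases hQ : Q
    · let h := MorphismProperty.factorizationData (trivialCofibrations D) (fibrations D)
        (terminal.from X)
      exact ⟨X, h.Z, 𝟙 X, h.i, 0, 𝟙 X, inferInstance, inferInstance, fun h => absurd hQ h,
        fun _ => Category.id_comp _, fun h => absurd h hP,
        fun _ => (isFibrant_iff_of_isTerminal h.p terminalIsTerminal).2 inferInstance⟩
    · exact ⟨X, X, 𝟙 X, 𝟙 X, 𝟙 X, 𝟙 X, inferInstance, inferInstance, fun _ => Category.id_comp _,
        fun _ => Category.id_comp _, fun h => absurd h hP, fun h => absurd h hQ⟩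

end

/-! ### Rectification -/

variable {D : Type u} [Category.{v} D] [ModelCategory D] [ProperModelCategory D]
  [SimplicialCategory D] [SimplicialModelCategory D] [HasZeroMorphisms D] [HasZeroObject D]

/-- The zigzag is `U_k ⟵ X̃_k ⟶ X̃_k / V_k`. -/
lemma ConeSystem.isRectifiable {U : ℕ → D} (K : ConeSystem U) {N : ℕ} {X : ComposableArrows D N}
    (h : WeaklyEquivalent X (ofSequence N (Z := U) fun i => K.F 0 i (i + 1) rfl)) : IsRectifiable X :=
  isRectifiable_of_ofSequence (fun i => (K.tower i).strictMap)
    ((h.trans _ _ _ (weaklyEquivalent_ofSequence N (fun i => (K.tower i).map) _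
      (fun i => (K.tower i).toU) (fun i _ => (K.tower i).map_toU) fun _ => inferInstance).symm).trans
      _ _ _ (weaklyEquivalent_ofSequence N _ _ (fun i => (K.tower i).toStrict)
        (fun i _ => (K.tower i).toStrict_strictMap.symm) fun _ => inferInstance))
    fun i => (K.tower i).strictMap_strictMap

end Toda

/-- The proof does not use the hypothesis that the system is strongly cofibrant: it replaces the
first object of the diagram by a cofibrant one and the last object by a fibrant one. -/
theorem mainTheorem4 {D : Type u} [Category.{v} D] [ModelCategory D] [Toda.ProperModelCategory D]
    [SimplicialCategory D] [Toda.SimplicialModelCategory D] [HasZeroMorphisms D] [HasZeroObject D]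
    (n : ℕ) (X : ComposableArrows D (n + 2)) (S : Toda.CubicalTodaSystem n (n + 2) X)
    (hS : S.IsStronglyCofibrant) (hT : Toda.IsNullhomotopic S.todaBracket) :
    Toda.IsRectifiable X := by
  choose V U a b s e ha hb hs he hU hU' using fun i : ℕ =>
    Toda.exists_replacement (X.obj (Toda.clamp (n + 2) i)) (i = 0) (i = n + 2) (by lia)
  have := hU 0 rfl
  have := hU' (n + 2) rfl
  obtain ⟨K, hK⟩ := S.exists_coneSystem hT s (fun i => e i ≫ b i) fun i h₀ h₁ => by
    rw [Category.assoc, hs i h₁, he i h₀]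
  let x (i : ℕ) := X.map (homOfLE (Toda.clamp_le (n + 2) i))
  -- The diagram `V` maps to `X` by `a` and to `U` by `b`. Below the last index `b ≫ s = a`, and `e
  -- ≫ a` is the identity above index `0`, so the squares over `X` commute where they are needed.
  let z (i : ℕ) : V i ⟶ V (i + 1) := b i ≫ s i ≫ x i ≫ e (i + 1)
  have h₁ : Toda.WeaklyEquivalent (Toda.ofSequence (n + 2) z) (Toda.ofSequence (n + 2) x) :=
    Toda.weaklyEquivalent_ofSequence _ _ _ a (fun i hi => by
      simp only [z, Category.assoc, he (i + 1) i.succ_ne_zero, Category.comp_id]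
      rw [← Category.assoc, hs i hi.ne]) ha
  have h₂ : Toda.WeaklyEquivalent (Toda.ofSequence (n + 2) z)
      (Toda.ofSequence (n + 2) (Z := U) fun i => K.F 0 i (i + 1) rfl) :=
    Toda.weaklyEquivalent_ofSequence _ _ _ b (fun i hi => by
      rw [hK i hi]
      simp only [z, x, Category.assoc]) hb
  exact K.isRectifiable (((Toda.weaklyEquivalent_clamp X).trans _ _ _ h₁.symm).trans _ _ _ h₂)
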